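/- **Setting.** Let $M$ be a smooth $n$-dimensional manifold with induced coordinates $(x^\mu,y^\mu)$ on $TM$; write $\partial_\mu=\partial/\partial x^\mu$, $\dot\partial_\mu=\partial/\partial y^\mu$. An *FP-space* is $M$ with $n$ smooth sections $\lambda_i(x,y)\in T_xM$ ($y\neq 0$) of the pull-back bundle over $TM\setminus 0$ that are linearly independent and positively homogeneous of degree $0$ in $y$, and such that $\dot\partial_\alpha g_{\mu\nu}$ is totally symmetric, where $g_{\mu\nu}=\sum_i\lambda_{i\mu}\lambda_{i\nu}$ and $(\lambda_{i\mu})$ is the inverse matrix of $(\lambda_i^\mu)$. Its Finsler structure is $F=\sqrt{g_{\mu\nu}y^\mu y^\nu}$, with Finsler metric $\tfrac12\dot\partial_\mu\dot\partial_\nu F^2$ (which equals $g_{\mu\nu}$) and Cartan tensor $C_{\beta\mu\nu}=\tfrac14\dot\partial_\beta\dot\partial_\mu\dot\partial_\nu F^2$. Let $\gamma^\alpha_{\mu\nu}$ be the formal Christoffel symbols of the Finsler metric, formed with $\partial_\mu$, and put $G^\alpha=\tfrac12\gamma^\alpha_{\mu\nu}y^\mu y^\nu$, $N^\alpha_\beta=\dot\partial_\beta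 G^\alpha$, $G^\alpha_{\sigma\beta}=\dot\partial_\beta N^\alpha_\sigma$ and $\delta_\mu=\partial_\mu-N^\alpha_\mu\dot\partial_\alpha$. A Finsler connection is a triple $(\mathbf F^\alpha_{\mu\nu},\mathbf N^\alpha_\mu,\mathbf C^\alpha_{\mu\nu})$. Its covariant derivatives are $X^\alpha_{\mu|\nu}=\delta_\nu X^\alpha_\mu+X^\eta_\mu\mathbf F^\alpha_{\eta\nu}-X^\alpha_\eta\mathbf F^\eta_{\mu\nu}$ and $X^\alpha_{\mu||\nu}=\dot\partial_\nu X^\alpha_\mu+X^\eta_\mu\mathbf C^\alpha_{\eta\nu}-X^\alpha_\eta\mathbf C^\eta_{\mu\nu}$, and similarly for all other types. Its torsions are $\mathbf T^\alpha_{\mu\nu}=\mathbf F^\alpha_{\mu\nu}-\mathbf F^\alpha_{\nu\mu}$ ((h)h), $\mathbf C^\alpha_{\mu\nu}$ ((h)hv), $\mathbf R^\alpha_{\mu\nu}=\delta_\nu\mathbf N^\alpha_\mu-\delta_\mu\mathbf N^\alpha_\nu$ ((v)h), $\mathbf P^\alpha_{\mu\nu}=\dot\partial_\nu\mathbf N^\alpha_\mu-\mathbf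 F^\alpha_{\mu\nu}$ ((v)hv), $\mathbf S^\alpha_{\mu\nu}=\mathbf C^\alpha_{\mu\nu}-\mathbf C^\alpha_{\nu\mu}$ ((v)v). With $\mathfrak U_{(\nu,\sigma)}$ the alternate sum $A_{\nu\sigma}-A_{\sigma\nu}$, its curvatures are $\mathbf R^\alpha_{\mu\nu\sigma}=\mathfrak U_{(\nu,\sigma)}\{\delta_\sigma\mathbf F^\alpha_{\mu\nu}+\mathbf F^\eta_{\mu\nu}\mathbf F^\alpha_{\eta\sigma}\}+\mathbf C^\alpha_{\mu\eta}\mathbf R^\eta_{\nu\sigma}$ (h), $\mathbf P^\alpha_{\mu\nu\sigma}=\dot\partial_\sigma\mathbf F^\alpha_{\mu\nu}-\mathbf C^\alpha_{\mu\sigma|\nu}+\mathbf C^\alpha_{\mu\eta}\mathbf P^\eta_{\nu\sigma}$ (hv), $\mathbf S^\alpha_{\mu\nu\sigma}=\mathfrak U_{(\nu,\sigma)}\{\dot\partial_\sigma\mathbf C^\alpha_{\mu\nu}+\mathbf C^\eta_{\mu\nu}\mathbf C^\alpha_{\eta\sigma}\}$ (v). The connections of an FP-space all have nonlinear part $N^\alpha_\mu$.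 They are: the *Cartan* connection $(\mathring\Gamma,N,\mathring C)$, where $\mathring\Gamma^\alpha_{\mu\nu}$ and $\mathring C^\alpha_{\mu\nu}$ are the Christoffel symbols of the Finsler metric formed with $\delta_\mu$ and with $\dot\partial_\mu$ respectively; the *Miron* connection, defined in the same way from $\sum_i\lambda_{i\mu}\lambda_{i\nu}$; the *Berwald* connection $(G^\alpha_{\mu\nu},N,0)$; the *canonical* connection with $\Gamma^\alpha_{\mu\nu}=\mathring\Gamma^\alpha_{\mu\nu}+\lambda_i^\alpha\lambda_{i\mu|\nu}$ and $C^\alpha_{\mu\nu}=\mathring C^\alpha_{\mu\nu}+\lambda_i^\alpha\lambda_{i\mu||\nu}$ (summed over $i$, with covariant derivatives for the Miron connection); the *dual* connection $(\Gamma^\alpha_{\nu\mu},N,C^\alpha_{\nu\mu})$. The FP-space is *FP-Minkowskian* if the Cartan connection satisfies $\mathring R^\alpha_{\mu\nu\sigma}=0$ and $\mathring C^\alpha_{\mu\nu|\beta}=0$ (horizontal derivative for the Cartan connection). A tensor vanishes if its components vanish in every chart, at all $y\ne0$. **Proposition 4.11.** In an FP-Minkowskian manifold the following hold in all coordinate systems,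 for all $y\neq0$. (a) The vertical covariant derivatives of tensor fields of any type $(r,s)$ are as in a general FP-space: their vertical coefficients are $g^{\alpha\eta}C_{\eta\mu\nu}$ for the Cartan (Miron) connection, $\lambda_i^\alpha\dot\partial_\nu\lambda_{i\mu}$ for the canonical connection, $\lambda_i^\alpha\dot\partial_\mu\lambda_{i\nu}$ for the dual connection, and $0$ for the Berwald connection. (b) The (v)h-torsion $R^\alpha_{\mu\nu}$ of each of these connections vanishes. (c) All five torsion tensors and all three curvature tensors of the Berwald connection vanish. (d) All torsion tensors of the Cartan connection except the (h)hv-torsion $\mathring C^\alpha_{\mu\nu}$ vanish, and all its curvature tensors except the v-curvature $\mathring S^\alpha_{\mu\nu\sigma}$ vanish. Moreover, if instead only $\mathring R^\alpha_{\mu\nu\sigma}=0=\mathring P^\alpha_{\mu\nu\sigma}$ is assumed (the h- and hv-curvatures of the Cartan connection), then (a), (b), (d) hold, and so does (c) except that the hv-curvature of the Berwald connection is $\bar P^\alpha_{\mu\nu\sigma}=\mathring C^\alpha_{\mu\sigma|\nu}$. -/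

import Mathlib

open scoped Manifold ContDiff

noncomputable section

namespace FPGeometry

/-- The model space of an `n`-dimensional manifold; also the space of coordinates `(x^μ)` and of
fibre coordinates `(y^μ)`. -/
abbrev Coord (n : ℕ) : Type := EuclideanSpace ℝ (Fin n)

/-- A real function `f(x, y)` of the coordinates of a local chart of `TM`. -/
abbrev Fld (n : ℕ) : Type := Coord n → Coord n → ℝ

/-! ### Local calculus in one chart of `TM` -/

section Local

variable {n : ℕ}

/-- `∂_μ f`, the partial derivative with respect to `x^μ`. -/
def dX (μ : Fin n) (f : Fld n) : Fld n := fun x y =>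
  fderiv ℝ (fun x' => f x' y) x (EuclideanSpace.single μ 1)

/-- `∂̇_μ f`, the partial derivative with respect to `y^μ`. -/
def dY (μ : Fin n) (f : Fld n) : Fld n := fun x y =>
  fderiv ℝ (fun y' => f x y') y (EuclideanSpace.single μ 1)

/-- `δ_μ f = ∂_μ f - N^α_μ ∂̇_α f`; the coefficient `N^α_μ` is written `N α μ`. -/
def delta (N : Fin n → Fin n → Fld n) (μ : Fin n) (f : Fld n) : Fld n := fun x y =>
  dX μ f x y - ∑ α, N α μ x y * dY α f x y

/-- The inverse `g^{αη}` of a matrix of functions `g_{αη}`. -/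
def inverse (g : Fin n → Fin n → Fld n) (α η : Fin n) : Fld n := fun x y =>
  (Matrix.of fun μ ν => g μ ν x y)⁻¹ α η

/-- The Christoffel symbols `½ g^{αη} (d_μ g_{νη} + d_ν g_{μη} - d_η g_{μν})` formed with the
derivations `d_μ`: these are the formal, the `δ`- and the `∂̇`-Christoffel symbols for `d = ∂`,
`d = δ` and `d = ∂̇` respectively. -/
def christoffel (d : Fin n → Fld n → Fld n) (g : Fin n → Fin n → Fld n) (α μ ν : Fin n) : Fld n :=
  fun x y => (1 / 2) * ∑ η, inverse g α η x y *
    (d μ (g ν η) x y + d ν (g μ η) x y - d η (g μ ν) x y)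

/-- Components `X^{a_1 … a_r}_{b_1 … b_s}(x, y)` of a tensor field of type `(r, s)`. -/
abbrev Tens (n r s : ℕ) : Type := (Fin r → Fin n) → (Fin s → Fin n) → Fld n

/-- Components of a tensor field of type `(0, 1)`. -/
def tens01 (X : Fin n → Fld n) : Tens n 0 1 := fun _ b => X (b 0)

/-- Components `X^α_{μν}` of a tensor field of type `(1, 2)`. -/
def tens12 (X : Fin n → Fin n → Fin n → Fld n) : Tens n 1 2 := fun a b => X (a 0) (b 0) (b 1)

/-- `∂̇_ν X + X^{… η …} C^α_{ην} + … - X_{… η …} C^η_{μν} - …`: the vertical covariant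
derivative of a tensor field of type `(r, s)` formed with the coefficients `C^α_{μν} = C α μ ν`. -/
def vDeriv (C : Fin n → Fin n → Fin n → Fld n) {r s : ℕ} (X : Tens n r s)
    (a : Fin r → Fin n) (b : Fin s → Fin n) (ν : Fin n) : Fld n := fun x y =>
  dY ν (X a b) x y
    + ∑ k, ∑ η, X (Function.update a k η) b x y * C (a k) η ν x y
    - ∑ l, ∑ η, X a (Function.update b l η) x y * C η (b l) ν x y

variable (n) in
/-- The coefficients `(F^α_{μν}, N^α_μ, C^α_{μν})` of a Finsler connection in one chart. -/
structure Connection where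
  /-- the horizontal coefficients `F^α_{μν}` -/
  F : Fin n → Fin n → Fin n → Fld n
  /-- the coefficients `N^α_μ` of the nonlinear connection -/
  N : Fin n → Fin n → Fld n
  /-- the vertical coefficients `C^α_{μν}` -/
  C : Fin n → Fin n → Fin n → Fld n

namespace Connection

variable (D : Connection n)

/-- The horizontal covariant derivative `X_{|ν}` of a tensor field of type `(r, s)`. -/
def hCov {r s : ℕ} (X : Tens n r s) (a : Fin r → Fin n) (b : Fin s → Fin n) (ν : Fin n) :
    Fld n := fun x y =>
  delta D.N ν (X a b) x y
    + ∑ k, ∑ η, X (Function.update a k η) b x y * D.F (a k) η ν x y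
    - ∑ l, ∑ η, X a (Function.update b l η) x y * D.F η (b l) ν x y

/-- The vertical covariant derivative `X_{||ν}` of a tensor field of type `(r, s)`. -/
def vCov {r s : ℕ} (X : Tens n r s) (a : Fin r → Fin n) (b : Fin s → Fin n) (ν : Fin n) :
    Fld n := vDeriv D.C X a b ν

/-- The `(h)h`-torsion `T^α_{μν} = F^α_{μν} - F^α_{νμ}`. -/
def torsionT (α μ ν : Fin n) : Fld n := fun x y => D.F α μ ν x y - D.F α ν μ x y

/-- The `(h)hv`-torsion `C^α_{μν}`. -/
def torsionC (α μ ν : Fin n) : Fld n := D.C α μ ν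

/-- The `(v)h`-torsion `R^α_{μν} = δ_ν N^α_μ - δ_μ N^α_ν`. -/
def torsionR (α μ ν : Fin n) : Fld n := fun x y =>
  delta D.N ν (D.N α μ) x y - delta D.N μ (D.N α ν) x y

/-- The `(v)hv`-torsion `P^α_{μν} = ∂̇_ν N^α_μ - F^α_{μν}`. -/
def torsionP (α μ ν : Fin n) : Fld n := fun x y => dY ν (D.N α μ) x y - D.F α μ ν x y

/-- The `(v)v`-torsion `S^α_{μν} = C^α_{μν} - C^α_{νμ}`. -/
def torsionS (α μ ν : Fin n) : Fld n := fun x y => D.C α μ ν x y - D.C α ν μ x y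

/-- The `h`-curvature
`R^α_{μνσ} = 𝔘_{(ν,σ)} {δ_σ F^α_{μν} + F^η_{μν} F^α_{ησ}} + C^α_{μη} R^η_{νσ}`. -/
def curvR (α μ ν σ : Fin n) : Fld n := fun x y =>
  (delta D.N σ (D.F α μ ν) x y + ∑ η, D.F η μ ν x y * D.F α η σ x y)
    - (delta D.N ν (D.F α μ σ) x y + ∑ η, D.F η μ σ x y * D.F α η ν x y)
    + ∑ η, D.C α μ η x y * D.torsionR η ν σ x y

/-- The `hv`-curvature `P^α_{μνσ} = ∂̇_σ F^α_{μν} - C^α_{μσ|ν} + C^α_{μη} P^η_{νσ}`. -/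
def curvP (α μ ν σ : Fin n) : Fld n := fun x y =>
  dY σ (D.F α μ ν) x y - D.hCov (tens12 D.C) ![α] ![μ, σ] ν x y
    + ∑ η, D.C α μ η x y * D.torsionP η ν σ x y

/-- The `v`-curvature `S^α_{μνσ} = 𝔘_{(ν,σ)} {∂̇_σ C^α_{μν} + C^η_{μν} C^α_{ησ}}`. -/
def curvS (α μ ν σ : Fin n) : Fld n := fun x y =>
  (dY σ (D.C α μ ν) x y + ∑ η, D.C η μ ν x y * D.C α η σ x y)
    - (dY ν (D.C α μ σ) x y + ∑ η, D.C η μ σ x y * D.C α η ν x y)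

end Connection

end Local

/-! ### Parallelizations of the pull-back bundle in coordinates -/

section Frame

variable {n : ℕ} {M : Type*} [TopologicalSpace M] [ChartedSpace (Coord n) M]

/-- The component `λ_i^α(x, y)` in the chart `e` of the `i`-th field of a family of `π`-vector
fields `λ_i(p, v) ∈ T_p M`, where `(x, y)` are the coordinates of `(p, v)`. -/
def frame
    (lam : Fin n → (p : M) → TangentSpace 𝓘(ℝ, Coord n) p → TangentSpace 𝓘(ℝ, Coord n) p)
    (e : OpenPartialHomeomorph M (Coord n)) (i α : Fin n) : Fld n := fun x y =>
  (show Coord n from mfderiv 𝓘(ℝ, Coord n) 𝓘(ℝ, Coord n) e (e.symm x)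
    (lam i (e.symm x) (mfderiv 𝓘(ℝ, Coord n) 𝓘(ℝ, Coord n) e.symm x y))) α

/-- `λ_{iμ}(x, y)`: the inverse of the matrix `(λ_i^α)`. -/
def coframe
    (lam : Fin n → (p : M) → TangentSpace 𝓘(ℝ, Coord n) p → TangentSpace 𝓘(ℝ, Coord n) p)
    (e : OpenPartialHomeomorph M (Coord n)) (i μ : Fin n) : Fld n := fun x y =>
  (Matrix.of fun α j => frame lam e j α x y)⁻¹ i μ

/-- The metric `g_{μν} = λ_{iμ} λ_{iν}` (sum over `i`) of the parallelization. -/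
def frameMetric
    (lam : Fin n → (p : M) → TangentSpace 𝓘(ℝ, Coord n) p → TangentSpace 𝓘(ℝ, Coord n) p)
    (e : OpenPartialHomeomorph M (Coord n)) (μ ν : Fin n) : Fld n := fun x y =>
  ∑ i, coframe lam e i μ x y * coframe lam e i ν x y

end Frame

/-- A Finslerized parallelizable space (FP-space): an `n`-dimensional smooth manifold `M` with `n`
independent smooth sections `λ_i(x, y)` of the pull-back bundle over the slit tangent bundle,
positively homogeneous of degree `0` in `y`, such that `∂̇_α g_{μν}` is totally symmetric, where
`g_{μν} = λ_{iμ} λ_{iν}`. The values of `lam` at `y = 0` play no role. -/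
structure FPSpace (n : ℕ) (M : Type*) [TopologicalSpace M] [ChartedSpace (Coord n) M]
    [IsManifold 𝓘(ℝ, Coord n) ∞ M] where
  /-- the `π`-vector fields `λ_i` -/
  lam : Fin n → (p : M) → TangentSpace 𝓘(ℝ, Coord n) p → TangentSpace 𝓘(ℝ, Coord n) p
  smooth : ∀ e ∈ IsManifold.maximalAtlas 𝓘(ℝ, Coord n) ∞ M, ∀ i α,
    ContDiffOn ℝ ∞ (fun z : Coord n × Coord n => frame lam e i α z.1 z.2) (e.target ×ˢ {0}ᶜ)
  independent : ∀ (p : M) (v : TangentSpace 𝓘(ℝ, Coord n) p), v ≠ 0 →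
    LinearIndependent ℝ fun i => lam i p v
  homogeneous : ∀ (i : Fin n) (p : M) (v : TangentSpace 𝓘(ℝ, Coord n) p), v ≠ 0 →
    ∀ a : ℝ, 0 < a → lam i p (a • v) = lam i p v
  totally_symmetric : ∀ e ∈ IsManifold.maximalAtlas 𝓘(ℝ, Coord n) ∞ M,
    ∀ x ∈ e.target, ∀ y : Coord n, y ≠ 0 → ∀ α μ ν,
      dY α (frameMetric lam e μ ν) x y = dY μ (frameMetric lam e α ν) x y

namespace FPSpace

variable {n : ℕ} {M : Type*} [TopologicalSpace M] [ChartedSpace (Coord n) M]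
  [IsManifold 𝓘(ℝ, Coord n) ∞ M] (S : FPSpace n M) (e : OpenPartialHomeomorph M (Coord n))

/-- The Finsler structure `F(x, y) = √(g_{μν}(x, y) y^μ y^ν)`. -/
def finsler : Fld n := fun x y =>
  Real.sqrt (∑ μ, ∑ ν, frameMetric S.lam e μ ν x y * y μ * y ν)

/-- The Finsler metric `½ ∂̇_μ ∂̇_ν F²`. -/
def finslerMetric (μ ν : Fin n) : Fld n := fun x y =>
  (1 / 2) * dY μ (dY ν fun x' y' => S.finsler e x' y' ^ 2) x y

/-- The Cartan tensor `C_{βμν} = ¼ ∂̇_β ∂̇_μ ∂̇_ν F²`. -/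
def cartanTensor (β μ ν : Fin n) : Fld n := fun x y =>
  (1 / 4) * dY β (dY μ (dY ν fun x' y' => S.finsler e x' y' ^ 2)) x y

/-- The canonical spray `G^α = ½ γ^α_{μν} y^μ y^ν`, where `γ^α_{μν}` are the formal Christoffel
symbols of the Finsler metric. -/
def spray (α : Fin n) : Fld n := fun x y =>
  (1 / 2) * ∑ μ, ∑ ν, christoffel dX (S.finslerMetric e) α μ ν x y * y μ * y ν

/-- The Barthel connection `N^α_β = ∂̇_β G^α`. -/
def barthel (α β : Fin n) : Fld n := dY β (S.spray e α)

/-- The Cartan connection of the Finsler structure. -/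
def cartan : Connection n where
  F := christoffel (delta (S.barthel e)) (S.finslerMetric e)
  N := S.barthel e
  C := christoffel dY (S.finslerMetric e)

/-- The Berwald connection `(G^α_{σβ}, N^α_β, 0)`, `G^α_{σβ} = ∂̇_β N^α_σ`. -/
def berwald : Connection n where
  F := fun α σ β => dY β (S.barthel e α σ)
  N := S.barthel e
  C := fun _ _ _ _ _ => 0

/-- The Miron connection of the metric `g_{μν} = λ_{iμ} λ_{iν}`, with the Barthel connection as
its nonlinear connection. -/
def miron : Connection n where
  F := christoffel (delta (S.barthel e)) (frameMetric S.lam e)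
  N := S.barthel e
  C := christoffel dY (frameMetric S.lam e)

/-- The canonical connection: the Miron connection plus the contortion tensors, formed with the
horizontal and vertical covariant derivatives of `λ_{iμ}` for the Miron connection. -/
def canonical : Connection n where
  F := fun α μ ν x y => (S.miron e).F α μ ν x y + ∑ i, frame S.lam e i α x y *
    (S.miron e).hCov (tens01 (coframe S.lam e i)) ![] ![μ] ν x y
  N := S.barthel e
  C := fun α μ ν x y => (S.miron e).C α μ ν x y + ∑ i, frame S.lam e i α x y *
    (S.miron e).vCov (tens01 (coframe S.lam e i)) ![] ![μ] ν x y

/-- The dual connection `(Γ^α_{νμ}, N^α_μ, C^α_{νμ})` of the canonical connection. -/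
def dual : Connection n where
  F := fun α μ ν => (S.canonical e).F α ν μ
  N := (S.canonical e).N
  C := fun α μ ν => (S.canonical e).C α ν μ

/-- A statement `Q e x y` about components holds in all coordinate systems, at all points
of the slit tangent bundle. -/
def Everywhere (_S : FPSpace n M)
    (Q : OpenPartialHomeomorph M (Coord n) → Coord n → Coord n → Prop) : Prop :=
  ∀ e ∈ IsManifold.maximalAtlas 𝓘(ℝ, Coord n) ∞ M, ∀ x ∈ e.target, ∀ y : Coord n, y ≠ 0 → Q e x y

/-- FP-Minkowskian manifolds: the `h`-curvature tensor of the Cartan connection and the horizontal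
covariant derivative of its `(h)hv`-torsion tensor (with respect to the Cartan connection) vanish,
which is the tensorial form of local Minkowskianity. -/
def IsMinkowskian : Prop :=
  S.Everywhere fun e x y =>
    (∀ α μ ν σ, (S.cartan e).curvR α μ ν σ x y = 0) ∧
    (∀ α μ ν β, (S.cartan e).hCov (tens12 (S.cartan e).C) ![α] ![μ, ν] β x y = 0)

/-- The `h`- and the `hv`-curvature tensor of the Cartan connection vanish. The vanishing of the
latter tensor alone says that the Finsler space is a Landsberg space, so that this is formally
weaker than `IsMinkowskian`. -/
def CartanCurvaturesVanish : Prop :=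
  S.Everywhere fun e x y =>
    (∀ α μ ν σ, (S.cartan e).curvR α μ ν σ x y = 0) ∧
    (∀ α μ ν σ, (S.cartan e).curvP α μ ν σ x y = 0)

/-- The vertical covariant derivatives of all tensor fields are given by the formulas of a general
FP-space: the vertical coefficients are `g^{αη} C_{ημν}` for the Cartan (Miron) connection, with the
Cartan tensor `C_{ημν}`, they are `λ_i^α ∂̇_ν λ_{iμ}` for the canonical connection, `λ_i^α ∂̇_μ λ_{iν}`
for the dual connection, and they vanish for the Berwald connection. -/
def VerticalDerivativesGeneral (x y : Coord n) : Prop :=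
  ∀ (r s : ℕ) (X : Tens n r s) (a : Fin r → Fin n) (b : Fin s → Fin n) (ν : Fin n),
    (S.cartan e).vCov X a b ν x y = vDeriv (fun α μ σ x' y' =>
      ∑ η, inverse (S.finslerMetric e) α η x' y' * S.cartanTensor e η μ σ x' y') X a b ν x y ∧
    (S.miron e).vCov X a b ν x y = vDeriv (fun α μ σ x' y' =>
      ∑ η, inverse (S.finslerMetric e) α η x' y' * S.cartanTensor e η μ σ x' y') X a b ν x y ∧
    (S.canonical e).vCov X a b ν x y = vDeriv (fun α μ σ x' y' =>
      ∑ i, frame S.lam e i α x' y' * dY σ (coframe S.lam e i μ) x' y') X a b ν x y ∧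
    (S.dual e).vCov X a b ν x y = vDeriv (fun α μ σ x' y' =>
      ∑ i, frame S.lam e i α x' y' * dY μ (coframe S.lam e i σ) x' y') X a b ν x y ∧
    (S.berwald e).vCov X a b ν x y = dY ν (X a b) x y

end FPSpace

end FPGeometry

end

/-!
Everything is local: in a chart with domain `U`, all objects are functions of `(x, y)` that are
smooth on `U × (ℝⁿ ∖ 0)`, and `∂_μ`, `∂̇_μ`, `δ_μ` act on them as derivations with the commutator
`[∂̇_σ, δ_β] f = - (∂̇_σ N^α_β) ∂̇_α f`.

Homogeneity of degree `0` and the total symmetry of `∂̇_α g_{μν}` give `y^μ ∂̇_α g_{μν} = 0`, so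
`∂̇_β (g_{κν} y^ν) = g_{κβ}` and `½ ∂̇_μ ∂̇_ν F² = g_{μν}` (`finslerMetric_eq`); this already yields
the vertical coefficients. From here on only the properties in `IsFinslerMetric` are used.

Writing `y_κ = g_{κν} y^ν`, the spray satisfies `2 G_κ = y^μ ∂_μ y_κ - ½ ∂_κ F²`. Its vertical
derivative determines the Barthel connection (`lower_barthel`), and comparing with the
Christoffel symbols `F^α_{μν}` of the Cartan connection gives the central identity
`y^μ F^α_{μν} = N^α_ν` (`F_contract`). Together with `y^μ C^α_{μν} = 0` it shows that the
contraction of the `h`-curvature with `y^μ` is the `(v)h`-torsion and that of the `hv`-curvature is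
the `(v)hv`-torsion (`curvR_contract`, `curvP_contract`). Hence vanishing Cartan curvatures force
`R^α_{μν} = 0` and `P^α_{μν} = 0`. The latter says that the Berwald and Cartan connections have the
same horizontal coefficients, and the Berwald curvatures can be read off from the Cartan ones.

In the Minkowskian case the `hv`-curvature is not given. If `C_{κμν|β} = 0`, applying `∂̇_σ` to the
metricity equation `δ_β g_{μν} = F_{νμβ} + F_{μνβ}` expresses `g_{να} ∂̇_σ F^α_{μβ}`, symmetrized in
`μ, ν`, through the `(v)hv`-torsion (`lower_dY_F_add`). The Christoffel trick solves for
`∂̇_σ F^α_{μβ}`; contracting with `y^μ` gives `P^α_{μν} = 0`, then `∂̇_σ F^α_{μβ} = 0`, and so the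
`hv`-curvature vanishes (`curvP_eq_zero_of_hCov_C`).
-/

noncomputable section

namespace FPGeometry

variable {n : ℕ}

/-! ### Derivations of smooth functions on the slit tangent bundle -/

/-- `f` is smooth on the part of the slit tangent bundle over the coordinate domain `U`. -/
def SmoothOver (U : Set (Coord n)) (f : Fld n) : Prop :=
  ContDiffOn ℝ ∞ (fun z : Coord n × Coord n => f z.1 z.2) (U ×ˢ {0}ᶜ)

/-- `f` and `h` agree on the part of the slit tangent bundle over `U`. -/
def EqOver (U : Set (Coord n)) (f h : Fld n) : Prop :=
  ∀ x ∈ U, ∀ y, y ≠ 0 → f x y = h x y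

/-- The coordinate function `y^μ`. -/
def fibreCoord (μ : Fin n) : Fld n := fun _ y => y μ

/-- `d` acts as a derivation on the functions that are smooth over `U`. Leibniz rules hold only on
the slit bundle over `U`, where differentiability is known; `congr` says that `d` is local. -/
structure IsDerivationOver (U : Set (Coord n)) (d : Fld n → Fld n) : Prop where
  smooth : ∀ {f}, SmoothOver U f → SmoothOver U (d f)
  add : ∀ {f h}, SmoothOver U f → SmoothOver U h →
    EqOver U (d fun x y => f x y + h x y) fun x y => d f x y + d h x y
  mul : ∀ {f h}, SmoothOver U f → SmoothOver U h →
    EqOver U (d fun x y => f x y * h x y) fun x y => d f x y * h x y + f x y * d h x y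
  const : ∀ c, EqOver U (d fun _ _ => c) fun _ _ => 0
  congr : ∀ {f h}, EqOver U f h → EqOver U (d f) (d h)

variable {U : Set (Coord n)}

namespace SmoothOver

variable {f h : Fld n}

lemma congr (hf : SmoothOver U f) (e : EqOver U h f) : SmoothOver U h :=
  ContDiffOn.congr hf fun z hz => e z.1 hz.1 z.2 hz.2

lemma const (c : ℝ) : SmoothOver U fun _ _ => c := contDiffOn_const

lemma add (hf : SmoothOver U f) (hh : SmoothOver U h) : SmoothOver U fun x y => f x y + h x y :=
  ContDiffOn.add hf hh

lemma sub (hf : SmoothOver U f) (hh : SmoothOver U h) : SmoothOver U fun x y => f x y - h x y :=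
  ContDiffOn.sub hf hh

lemma mul (hf : SmoothOver U f) (hh : SmoothOver U h) : SmoothOver U fun x y => f x y * h x y :=
  ContDiffOn.mul hf hh

lemma sum {ι : Type*} {s : Finset ι} {f : ι → Fld n} (hf : ∀ i, SmoothOver U (f i)) :
    SmoothOver U fun x y => ∑ i ∈ s, f i x y :=
  ContDiffOn.sum fun i _ => hf i

lemma prod {ι : Type*} {s : Finset ι} {f : ι → Fld n} (hf : ∀ i, SmoothOver U (f i)) :
    SmoothOver U fun x y => ∏ i ∈ s, f i x y :=
  contDiffOn_prod fun i _ => hf i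

lemma fibreCoord (μ : Fin n) : SmoothOver U (fibreCoord μ) := by
  have : ContDiff ℝ ∞ fun z : Coord n × Coord n => z.2 μ := by fun_prop
  exact this.contDiffOn

lemma differentiableAt (hU : IsOpen U) (hf : SmoothOver U f) {x y : Coord n} (hx : x ∈ U)
    (hy : y ≠ 0) : DifferentiableAt ℝ (fun z : Coord n × Coord n => f z.1 z.2) (x, y) :=
  (ContDiffOn.contDiffAt hf ((hU.prod isOpen_compl_singleton).mem_nhds
    (Set.mk_mem_prod hx hy))).differentiableAt (by simp)

lemma differentiableAt_fst (hU : IsOpen U) (hf : SmoothOver U f) {x y : Coord n} (hx : x ∈ U)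
    (hy : y ≠ 0) : DifferentiableAt ℝ (fun x' => f x' y) x :=
  (hf.differentiableAt hU hx hy).comp (f := fun x' => (x', y)) x
    (differentiableAt_id.prodMk (differentiableAt_const y))

lemma differentiableAt_snd (hU : IsOpen U) (hf : SmoothOver U f) {x y : Coord n} (hx : x ∈ U)
    (hy : y ≠ 0) : DifferentiableAt ℝ (fun y' => f x y') y :=
  (hf.differentiableAt hU hx hy).comp (f := fun y' => (x, y')) y
    ((differentiableAt_const x).prodMk differentiableAt_id)

lemma dX_eq (hU : IsOpen U) (hf : SmoothOver U f) (μ : Fin n) :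
    EqOver U (dX μ f) fun x y => fderiv ℝ (fun z : Coord n × Coord n => f z.1 z.2) (x, y)
      (EuclideanSpace.single μ 1, 0) := by
  intro x hx y hy
  have h := (hf.differentiableAt hU hx hy).hasFDerivAt.comp (f := fun x' => (x', y)) x
    ((hasFDerivAt_id x).prodMk (hasFDerivAt_const y x))
  simp only [dX]
  rw [show (fun x' => f x' y) = (fun z : Coord n × Coord n => f z.1 z.2) ∘ fun x' => (x', y) from
    rfl, h.fderiv]
  simp

lemma dY_eq (hU : IsOpen U) (hf : SmoothOver U f) (μ : Fin n) :
    EqOver U (dY μ f) fun x y => fderiv ℝ (fun z : Coord n × Coord n => f z.1 z.2) (x, y)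
      (0, EuclideanSpace.single μ 1) := by
  intro x hx y hy
  have h := (hf.differentiableAt hU hx hy).hasFDerivAt.comp (f := fun y' => (x, y')) y
    ((hasFDerivAt_const x y).prodMk (hasFDerivAt_id y))
  simp only [dY]
  rw [show (fun y' => f x y') = (fun z : Coord n × Coord n => f z.1 z.2) ∘ fun y' => (x, y') from
    rfl, h.fderiv]
  simp

lemma fderiv_apply (hU : IsOpen U) (hf : SmoothOver U f) (v : Coord n × Coord n) :
    SmoothOver U fun x y => fderiv ℝ (fun z : Coord n × Coord n => f z.1 z.2) (x, y) v :=
  (ContDiffOn.fderiv_of_isOpen hf (hU.prod isOpen_compl_singleton) (m := ∞) (by simp)).clm_apply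
    contDiffOn_const

lemma dX (hU : IsOpen U) (hf : SmoothOver U f) (μ : Fin n) : SmoothOver U (dX μ f) :=
  (hf.fderiv_apply hU _).congr (hf.dX_eq hU μ)

lemma dY (hU : IsOpen U) (hf : SmoothOver U f) (μ : Fin n) : SmoothOver U (dY μ f) :=
  (hf.fderiv_apply hU _).congr (hf.dY_eq hU μ)

/-- Directional derivatives of a smooth function commute. -/
lemma fderiv_comm (hU : IsOpen U) (hf : SmoothOver U f) (v w : Coord n × Coord n) {x y : Coord n}
    (hx : x ∈ U) (hy : y ≠ 0) :
    fderiv ℝ (fun z => fderiv ℝ (fun z : Coord n × Coord n => f z.1 z.2) z v) (x, y) w =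
      fderiv ℝ (fun z => fderiv ℝ (fun z : Coord n × Coord n => f z.1 z.2) z w) (x, y) v := by
  have hc : ContDiffAt ℝ ∞ (fun z : Coord n × Coord n => f z.1 z.2) (x, y) :=
    ContDiffOn.contDiffAt hf ((hU.prod isOpen_compl_singleton).mem_nhds (Set.mk_mem_prod hx hy))
  have hs : IsSymmSndFDerivAt ℝ (fun z : Coord n × Coord n => f z.1 z.2) (x, y) :=
    hc.isSymmSndFDerivAt (by
      rw [minSmoothness_of_isRCLikeNormedField]
      exact WithTop.coe_le_coe.2 (le_top (a := (2 : ℕ∞))))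
  have hd : DifferentiableAt ℝ (fderiv ℝ fun z : Coord n × Coord n => f z.1 z.2) (x, y) :=
    (hc.fderiv_right (m := ∞) (by simp)).differentiableAt (by simp)
  rw [fderiv_clm_apply hd (differentiableAt_const v), fderiv_clm_apply hd (differentiableAt_const w)]
  simpa using hs w v

end SmoothOver

lemma isDerivationOver_dX (hU : IsOpen U) (μ : Fin n) : IsDerivationOver U (dX μ) where
  smooth hf := hf.dX hU μ
  add hf hh x hx y hy := by
    simp only [dX]
    rw [fderiv_fun_add (hf.differentiableAt_fst hU hx hy) (hh.differentiableAt_fst hU hx hy)]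
    rfl
  mul hf hh x hx y hy := by
    simp only [dX]
    rw [fderiv_fun_mul (hf.differentiableAt_fst hU hx hy) (hh.differentiableAt_fst hU hx hy)]
    simp [mul_comm, add_comm]
  const c x hx y hy := by simp [dX]
  congr e x hx y hy := by
    simp only [dX]
    rw [Filter.EventuallyEq.fderiv_eq]
    filter_upwards [hU.mem_nhds hx] with x' hx' using e x' hx' y hy

lemma isDerivationOver_dY (hU : IsOpen U) (μ : Fin n) : IsDerivationOver U (dY μ) where
  smooth hf := hf.dY hU μ
  add hf hh x hx y hy := by
    simp only [dY]
    rw [fderiv_fun_add (hf.differentiableAt_snd hU hx hy) (hh.differentiableAt_snd hU hx hy)]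
    rfl
  mul hf hh x hx y hy := by
    simp only [dY]
    rw [fderiv_fun_mul (hf.differentiableAt_snd hU hx hy) (hh.differentiableAt_snd hU hx hy)]
    simp [mul_comm, add_comm]
  const c x hx y hy := by simp [dY]
  congr e x hx y hy := by
    simp only [dY]
    rw [Filter.EventuallyEq.fderiv_eq]
    filter_upwards [isOpen_compl_singleton.mem_nhds hy] with y' hy' using e x hx y' hy'

lemma isDerivationOver_delta (hU : IsOpen U) {N : Fin n → Fin n → Fld n}
    (hN : ∀ α μ, SmoothOver U (N α μ)) (μ : Fin n) : IsDerivationOver U (delta N μ) where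
  smooth hf := (hf.dX hU μ).sub (.sum fun α => (hN α μ).mul (hf.dY hU α))
  add hf hh x hx y hy := by
    simp only [delta, (isDerivationOver_dX hU _).add hf hh x hx y hy,
      (isDerivationOver_dY hU _).add hf hh x hx y hy, mul_add, Finset.sum_add_distrib]
    ring
  mul {f h} hf hh x hx y hy := by
    simp only [delta, (isDerivationOver_dX hU _).mul hf hh x hx y hy,
      (isDerivationOver_dY hU _).mul hf hh x hx y hy, mul_sub, sub_mul, Finset.mul_sum,
      Finset.sum_mul]
    rw [add_sub_assoc, sub_add, sub_sub_eq_add_sub]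
    simp only [mul_add, Finset.sum_add_distrib, mul_assoc, mul_left_comm (f x y)]
    ring
  const c x hx y hy := by
    simp [delta, (isDerivationOver_dX hU _).const c x hx y hy,
      (isDerivationOver_dY hU _).const c x hx y hy]
  congr e x hx y hy := by
    simp only [delta, (isDerivationOver_dX hU _).congr e x hx y hy,
      (isDerivationOver_dY hU _).congr e x hx y hy]

namespace IsDerivationOver

variable {d : Fld n → Fld n} {x y : Coord n}

lemma sum (hd : IsDerivationOver U d) (hx : x ∈ U) (hy : y ≠ 0) {ι : Type*} (s : Finset ι)
    {f : ι → Fld n} (hf : ∀ i, SmoothOver U (f i)) :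
    d (fun x y => ∑ i ∈ s, f i x y) x y = ∑ i ∈ s, d (f i) x y := by
  classical
  induction s using Finset.induction_on with
  | empty => simpa using hd.const 0 x hx y hy
  | insert a s ha ih =>
    simp only [Finset.sum_insert ha]
    rw [← ih]
    exact hd.add (hf a) (.sum hf) x hx y hy

lemma sum_mul (hd : IsDerivationOver U d) (hx : x ∈ U) (hy : y ≠ 0) {ι : Type*} [Fintype ι]
    {f h : ι → Fld n} (hf : ∀ i, SmoothOver U (f i)) (hh : ∀ i, SmoothOver U (h i)) :
    d (fun x y => ∑ i, f i x y * h i x y) x y =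
      ∑ i, d (f i) x y * h i x y + ∑ i, f i x y * d (h i) x y := by
  rw [hd.sum hx hy _ fun i => (hf i).mul (hh i), ← Finset.sum_add_distrib]
  exact Finset.sum_congr rfl fun i _ => hd.mul (hf i) (hh i) x hx y hy

lemma const_mul (hd : IsDerivationOver U d) (hx : x ∈ U) (hy : y ≠ 0) (c : ℝ) {f : Fld n}
    (hf : SmoothOver U f) : d (fun x y => c * f x y) x y = c * d f x y := by
  have h1 := hd.mul (.const c) hf x hx y hy
  simp only [hd.const c x hx y hy, zero_mul, zero_add] at h1
  exact h1

lemma sub (hd : IsDerivationOver U d) (hx : x ∈ U) (hy : y ≠ 0) {f h : Fld n}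
    (hf : SmoothOver U f) (hh : SmoothOver U h) :
    d (fun x y => f x y - h x y) x y = d f x y - d h x y := by
  have h1 := hd.add hf ((SmoothOver.const (-1)).mul hh) x hx y hy
  simp only [hd.const_mul hx hy _ hh] at h1
  rw [show (fun x y => f x y - h x y) = fun x y => f x y + -1 * h x y by funext; ring, h1]
  ring

end IsDerivationOver

section Commutation

variable {x y : Coord n} {f : Fld n}

lemma dY_dY_comm (hU : IsOpen U) (hf : SmoothOver U f) (hx : x ∈ U) (hy : y ≠ 0) (μ ν : Fin n) :
    dY μ (dY ν f) x y = dY ν (dY μ f) x y := by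
  rw [(isDerivationOver_dY hU μ).congr (hf.dY_eq hU ν) x hx y hy,
    (hf.fderiv_apply hU _).dY_eq hU μ x hx y hy,
    (isDerivationOver_dY hU ν).congr (hf.dY_eq hU μ) x hx y hy,
    (hf.fderiv_apply hU _).dY_eq hU ν x hx y hy]
  exact hf.fderiv_comm hU _ _ hx hy

lemma dY_dX_comm (hU : IsOpen U) (hf : SmoothOver U f) (hx : x ∈ U) (hy : y ≠ 0) (μ ν : Fin n) :
    dY μ (dX ν f) x y = dX ν (dY μ f) x y := by
  rw [(isDerivationOver_dY hU μ).congr (hf.dX_eq hU ν) x hx y hy,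
    (hf.fderiv_apply hU _).dY_eq hU μ x hx y hy,
    (isDerivationOver_dX hU ν).congr (hf.dY_eq hU μ) x hx y hy,
    (hf.fderiv_apply hU _).dX_eq hU ν x hx y hy]
  exact hf.fderiv_comm hU _ _ hx hy

/-- `[∂̇_σ, δ_β] f = - (∂̇_σ N^α_β) ∂̇_α f`. -/
lemma dY_delta (hU : IsOpen U) {N : Fin n → Fin n → Fld n} (hN : ∀ α μ, SmoothOver U (N α μ))
    (hf : SmoothOver U f) (hx : x ∈ U) (hy : y ≠ 0) (σ β : Fin n) :
    dY σ (delta N β f) x y =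
      delta N β (dY σ f) x y - ∑ α, dY σ (N α β) x y * dY α f x y := by
  have hd := isDerivationOver_dY hU (U := U) σ
  have h : dY σ (delta N β f) x y = dY σ (dX β f) x y -
      dY σ (fun x y => ∑ α, N α β x y * dY α f x y) x y :=
    hd.sub hx hy (hf.dX hU β) (.sum fun α => (hN α β).mul (hf.dY hU α))
  rw [h, hd.sum_mul hx hy (fun α => hN α β) (fun α => hf.dY hU α), dY_dX_comm hU hf hx hy]
  simp only [delta, dY_dY_comm hU hf hx hy σ]
  ring

lemma dX_fibreCoord (μ ν : Fin n) (x y : Coord n) : dX ν (fibreCoord μ) x y = 0 := by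
  simp [dX, fibreCoord]

lemma dY_fibreCoord (μ ν : Fin n) (x y : Coord n) :
    dY ν (fibreCoord μ) x y = if μ = ν then 1 else 0 := by
  simp only [dY, fibreCoord]
  have : (fun y' : Coord n => y' μ) = EuclideanSpace.proj (𝕜 := ℝ) μ := rfl
  rw [this, ContinuousLinearMap.fderiv]
  simp

lemma delta_fibreCoord (N : Fin n → Fin n → Fld n) (μ ν : Fin n) (x y : Coord n) :
    delta N ν (fibreCoord μ) x y = - N μ ν x y := by
  simp [delta, dX_fibreCoord, dY_fibreCoord]

end Commutation

/-! ### Inverse matrices of functions -/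

section Inverse

variable {x y : Coord n}

lemma smoothOver_det {k : Type*} [Fintype k] [DecidableEq k] {A : k → k → Fld n}
    (hA : ∀ i j, SmoothOver U (A i j)) :
    SmoothOver U fun x y => (Matrix.of fun i j => A i j x y).det := by
  simp only [Matrix.det_apply', Matrix.of_apply]
  exact .sum fun σ => (SmoothOver.const _).mul (.prod fun i => hA _ _)

/-- By Cramer's rule, the entries of the inverse of a smooth invertible matrix are smooth. -/
lemma smoothOver_inv {A : Fin n → Fin n → Fld n} (hA : ∀ i j, SmoothOver U (A i j))
    (hdet : ∀ x ∈ U, ∀ y, y ≠ 0 → (Matrix.of fun i j => A i j x y).det ≠ 0) (i j : Fin n) :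
    SmoothOver U fun x y => (Matrix.of fun i j => A i j x y)⁻¹ i j := by
  have h1 : SmoothOver U fun x y => ((Matrix.of fun i j => A i j x y).det)⁻¹ :=
    ContDiffOn.inv (smoothOver_det hA) fun z hz => hdet z.1 hz.1 z.2 hz.2
  have h2 : SmoothOver U fun x y => (Matrix.of fun i j => A i j x y).adjugate i j := by
    have : SmoothOver U fun x y => (Matrix.of fun k l => (if k = j then fun _ _ =>
        (Pi.single i 1 : Fin n → ℝ) l else A k l : Fld n) x y).det := by
      refine smoothOver_det fun k l => ?_
      split_ifs
      · exact .const _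
      · exact hA k l
    refine this.congr fun x _ y _ => ?_
    simp only [Matrix.adjugate_apply]
    congr 1
    ext k l
    by_cases hk : k = j <;> simp [Matrix.updateRow_apply, hk]
  refine (h1.mul h2).congr fun x _ y _ => ?_
  simp [Matrix.inv_def]

end Inverse

/-! ### Local Finsler metrics and their connections -/

/-- The local properties of a Finsler metric tensor over the coordinate domain `U`: a smooth
symmetric nondegenerate `g_{μν}(x, y)` with `y^α ∂̇_α g_{μν} = 0` (Euler's identity for degree `0`)
and totally symmetric `∂̇_α g_{μν}`. Positivity is not needed. -/
structure IsFinslerMetric (U : Set (Coord n)) (g : Fin n → Fin n → Fld n) : Prop where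
  isOpen : IsOpen U
  smooth : ∀ μ ν, SmoothOver U (g μ ν)
  symm : ∀ μ ν, EqOver U (g μ ν) (g ν μ)
  det_ne_zero : ∀ x ∈ U, ∀ y, y ≠ 0 → (Matrix.of fun μ ν => g μ ν x y).det ≠ 0
  total_symm : ∀ α μ ν, EqOver U (dY α (g μ ν)) (dY μ (g α ν))
  euler : ∀ μ ν, EqOver U (fun x y => ∑ α, dY α (g μ ν) x y * y α) fun _ _ => 0

section Definitions

variable (g : Fin n → Fin n → Fld n)

/-- The covector `y_κ = g_{κν} y^ν`. -/
def lowerY (κ : Fin n) : Fld n := fun x y => ∑ ν, g κ ν x y * fibreCoord ν x y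

/-- The energy `g_{κν} y^κ y^ν`. -/
def energy : Fld n := fun x y => ∑ κ, lowerY g κ x y * fibreCoord κ x y

/-- The spray `G^α = ½ γ^α_{μν} y^μ y^ν` of the metric `g`. -/
def sprayOf (α : Fin n) : Fld n := fun x y =>
  (1 / 2) * ∑ μ, ∑ ν, christoffel dX g α μ ν x y * y μ * y ν

/-- The Barthel connection `N^α_β = ∂̇_β G^α` of the metric `g`. -/
def barthelOf (α β : Fin n) : Fld n := dY β (sprayOf g α)

/-- The Cartan connection of the metric `g`. -/
def cartanOf : Connection n where
  F := christoffel (delta (barthelOf g)) g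
  N := barthelOf g
  C := christoffel dY g

/-- The Berwald connection of the metric `g`. -/
def berwaldOf : Connection n where
  F := fun α σ β => dY β (barthelOf g α σ)
  N := barthelOf g
  C := fun _ _ _ _ _ => 0

end Definitions

namespace IsFinslerMetric

variable {U : Set (Coord n)} {g : Fin n → Fin n → Fld n} (H : IsFinslerMetric U g)
include H

lemma isDX (μ : Fin n) : IsDerivationOver U (dX μ) := isDerivationOver_dX H.isOpen μ
lemma isDY (μ : Fin n) : IsDerivationOver U (dY μ) := isDerivationOver_dY H.isOpen μ

/-! ### Smoothness -/

lemma smooth_inverse (α η : Fin n) : SmoothOver U (inverse g α η) :=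
  smoothOver_inv H.smooth H.det_ne_zero α η

lemma smooth_christoffel {d : Fin n → Fld n → Fld n} (hd : ∀ μ, IsDerivationOver U (d μ))
    (α μ ν : Fin n) : SmoothOver U (christoffel d g α μ ν) :=
  (SmoothOver.const _).mul (.sum fun η => (H.smooth_inverse α η).mul
    ((((hd μ).smooth (H.smooth ν η)).add ((hd ν).smooth (H.smooth μ η))).sub
      ((hd η).smooth (H.smooth μ ν))))

lemma smooth_lowerY (κ : Fin n) : SmoothOver U (lowerY g κ) :=
  .sum fun ν => (H.smooth κ ν).mul (.fibreCoord ν)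

lemma smooth_energy : SmoothOver U (energy g) :=
  .sum fun κ => (H.smooth_lowerY κ).mul (.fibreCoord κ)

lemma smooth_spray (α : Fin n) : SmoothOver U (sprayOf g α) :=
  (SmoothOver.const _).mul (.sum fun μ => .sum fun ν =>
    ((H.smooth_christoffel H.isDX α μ ν).mul (.fibreCoord μ)).mul (.fibreCoord ν))

lemma smooth_barthel (α β : Fin n) : SmoothOver U (barthelOf g α β) :=
  (H.smooth_spray α).dY H.isOpen β

lemma isDelta (μ : Fin n) : IsDerivationOver U (delta (barthelOf g) μ) :=
  isDerivationOver_delta H.isOpen H.smooth_barthel μ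

lemma smooth_F (α μ ν : Fin n) : SmoothOver U ((cartanOf g).F α μ ν) :=
  H.smooth_christoffel H.isDelta α μ ν

lemma smooth_C (α μ ν : Fin n) : SmoothOver U ((cartanOf g).C α μ ν) :=
  H.smooth_christoffel H.isDY α μ ν

/-! ### Lowering indices -/

variable {x y : Coord n} (hx : x ∈ U) (hy : y ≠ 0)
include hx hy

lemma lower_inverse (t : Fin n → ℝ) (κ : Fin n) :
    ∑ α, g κ α x y * ∑ η, inverse g α η x y * t η = t κ := by
  have h : (Matrix.of fun μ ν => g μ ν x y).mulVec
      ((Matrix.of fun μ ν => g μ ν x y)⁻¹.mulVec t) = t := by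
    rw [Matrix.mulVec_mulVec, Matrix.mul_nonsing_inv _ (H.det_ne_zero x hx y hy).isUnit,
      Matrix.one_mulVec]
  exact congrFun h κ

lemma ext_of_lower {v w : Fin n → ℝ}
    (h : ∀ κ, ∑ α, g κ α x y * v α = ∑ α, g κ α x y * w α) (α : Fin n) : v α = w α :=
  congrFun (Matrix.mulVec_injective_of_isUnit
    ((Matrix.isUnit_iff_isUnit_det _).2 (H.det_ne_zero x hx y hy).isUnit) (funext h)) α

lemma lower_christoffel (d : Fin n → Fld n → Fld n) (κ μ ν : Fin n) :
    ∑ α, g κ α x y * christoffel d g α μ ν x y =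
      (1 / 2) * (d μ (g ν κ) x y + d ν (g μ κ) x y - d κ (g μ ν) x y) := by
  rw [← H.lower_inverse hx hy
    (fun η => (d μ (g ν η) x y + d ν (g μ η) x y - d η (g μ ν) x y)) κ, Finset.mul_sum]
  simp only [christoffel, mul_left_comm]

lemma christoffel_symm {d : Fin n → Fld n → Fld n} (hd : ∀ μ, IsDerivationOver U (d μ))
    (α μ ν : Fin n) : christoffel d g α μ ν x y = christoffel d g α ν μ x y := by
  simp only [christoffel, (hd _).congr (H.symm μ ν) x hx y hy, add_comm (d μ (g ν _) x y)]

lemma F_symm (α μ ν : Fin n) : (cartanOf g).F α μ ν x y = (cartanOf g).F α ν μ x y :=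
  H.christoffel_symm hx hy H.isDelta α μ ν

lemma C_symm (α μ ν : Fin n) : (cartanOf g).C α μ ν x y = (cartanOf g).C α ν μ x y :=
  H.christoffel_symm hx hy H.isDY α μ ν

lemma d_symm {d : Fld n → Fld n} (hd : IsDerivationOver U d) (μ ν : Fin n) :
    d (g μ ν) x y = d (g ν μ) x y := hd.congr (H.symm μ ν) x hx y hy

lemma dY_swap_right (β κ ν : Fin n) : dY β (g κ ν) x y = dY ν (g κ β) x y := by
  rw [H.d_symm hx hy (H.isDY β) κ ν, H.total_symm β ν κ x hx y hy, H.d_symm hx hy (H.isDY ν) β κ]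

lemma dY_contract (β κ : Fin n) : ∑ ν, dY β (g κ ν) x y * y ν = 0 := by
  simp only [H.dY_swap_right hx hy β κ]
  exact H.euler κ β x hx y hy

lemma dY_contract_left (β κ : Fin n) : ∑ ν, dY β (g ν κ) x y * y ν = 0 := by
  simp only [H.d_symm hx hy (H.isDY β) _ κ]
  exact H.dY_contract hx hy β κ

lemma lower_C (κ μ ν : Fin n) :
    ∑ α, g κ α x y * (cartanOf g).C α μ ν x y = (1 / 2) * dY κ (g μ ν) x y := by
  have h := H.lower_christoffel hx hy dY κ μ ν
  rw [H.total_symm μ ν κ x hx y hy, H.dY_swap_right hx hy ν μ κ] at h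
  refine h.trans ?_
  ring

lemma C_contract (α ν : Fin n) : ∑ μ, (cartanOf g).C α μ ν x y * y μ = 0 := by
  refine H.ext_of_lower hx hy (v := fun α => ∑ μ, (cartanOf g).C α μ ν x y * y μ)
    (w := fun _ => 0) (fun κ => ?_) α
  simp only [Finset.mul_sum, mul_zero, Finset.sum_const_zero]
  rw [Finset.sum_comm]
  simp only [← mul_assoc, ← Finset.sum_mul, H.lower_C hx hy]
  simp only [mul_assoc, ← Finset.mul_sum, H.dY_contract_left hx hy, mul_zero]

/-! ### The spray and the Barthel connection -/

lemma dY_lowerY (β κ : Fin n) : dY β (lowerY g κ) x y = g κ β x y := by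
  have h := (H.isDY β).sum_mul hx hy (fun ν => H.smooth κ ν) (fun ν => .fibreCoord ν)
  refine h.trans ?_
  simp only [dY_fibreCoord, fibreCoord, H.dY_contract hx hy]
  simp

lemma dY_energy (β : Fin n) : dY β (energy g) x y = 2 * lowerY g β x y := by
  have h := (H.isDY β).sum_mul hx hy (fun ν => H.smooth_lowerY ν) (fun ν => .fibreCoord ν)
  refine h.trans ?_
  simp only [dY_fibreCoord, H.dY_lowerY hx hy]
  have : ∑ i, g i β x y * fibreCoord i x y = lowerY g β x y :=
    Finset.sum_congr rfl fun i _ => by rw [H.symm i β x hx y hy]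
  rw [this]
  simp [two_mul]

lemma dX_lowerY (μ κ : Fin n) : dX μ (lowerY g κ) x y = ∑ ν, dX μ (g κ ν) x y * y ν := by
  have h := (H.isDX μ).sum_mul hx hy (fun ν => H.smooth κ ν) (fun ν => .fibreCoord ν)
  refine h.trans ?_
  simp [dX_fibreCoord, fibreCoord]

lemma dX_energy (μ : Fin n) : dX μ (energy g) x y = ∑ κ, dX μ (lowerY g κ) x y * y κ := by
  have h := (H.isDX μ).sum_mul hx hy (fun ν => H.smooth_lowerY ν) (fun ν => .fibreCoord ν)
  refine h.trans ?_
  simp [dX_fibreCoord, fibreCoord]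

/-- `2 G_κ = y^μ ∂_μ y_κ - ½ ∂_κ F²`, the Euler–Lagrange form of the spray. -/
lemma lower_spray (κ : Fin n) :
    ∑ α, g κ α x y * (2 * sprayOf g α x y) =
      ∑ μ, dX μ (lowerY g κ) x y * fibreCoord μ x y - (1 / 2) * dX κ (energy g) x y := by
  have h1 : ∑ α, g κ α x y * (2 * sprayOf g α x y) =
      ∑ μ, ∑ ν, (∑ α, g κ α x y * christoffel dX g α μ ν x y) * y μ * y ν := by
    simp only [sprayOf, Finset.mul_sum, Finset.sum_mul]
    rw [Finset.sum_comm]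
    refine Finset.sum_congr rfl fun μ _ => ?_
    rw [Finset.sum_comm]
    refine Finset.sum_congr rfl fun ν _ => Finset.sum_congr rfl fun α _ => ?_
    ring
  have h2 : ∑ μ, ∑ ν, dX ν (g μ κ) x y * y μ * y ν =
      ∑ μ, ∑ ν, dX μ (g ν κ) x y * y μ * y ν := by
    rw [Finset.sum_comm]
    refine Finset.sum_congr rfl fun μ _ => Finset.sum_congr rfl fun ν _ => ?_
    ring
  have h3 : ∑ μ, ∑ ν, dX μ (g ν κ) x y * y μ * y ν = ∑ μ, dX μ (lowerY g κ) x y * y μ := by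
    simp only [H.dX_lowerY hx hy, Finset.sum_mul]
    refine Finset.sum_congr rfl fun μ _ => Finset.sum_congr rfl fun ν _ => ?_
    rw [H.d_symm hx hy (H.isDX μ) ν κ]
    ring
  have h4 : ∑ μ, ∑ ν, dX κ (g μ ν) x y * y μ * y ν = dX κ (energy g) x y := by
    simp only [H.dX_energy hx hy, H.dX_lowerY hx hy, Finset.sum_mul]
    refine Finset.sum_congr rfl fun μ _ => Finset.sum_congr rfl fun ν _ => ?_
    ring
  rw [h1]
  simp only [H.lower_christoffel hx hy, fibreCoord]
  rw [← h4, ← h3]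
  have h5 : ∀ μ ν, 1 / 2 * (dX μ (g ν κ) x y + dX ν (g μ κ) x y - dX κ (g μ ν) x y) * y μ * y ν =
      1 / 2 * (dX μ (g ν κ) x y * y μ * y ν) + 1 / 2 * (dX ν (g μ κ) x y * y μ * y ν)
        - 1 / 2 * (dX κ (g μ ν) x y * y μ * y ν) := fun μ ν => by ring
  simp only [h5, Finset.sum_add_distrib, Finset.sum_sub_distrib, ← Finset.mul_sum, h2]
  ring

/-- The vertical derivative of `lower_spray`; the first sum on the left is the derivative falling
on `g_{κα}`. -/
lemma lower_barthel (κ β : Fin n) :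
    ∑ α, dY β (g κ α) x y * (2 * sprayOf g α x y) + ∑ α, g κ α x y * (2 * barthelOf g α β x y) =
      ∑ μ, dX μ (g κ β) x y * y μ + dX β (lowerY g κ) x y - dX κ (lowerY g β) x y := by
  have hG : ∀ α, SmoothOver U fun x y => 2 * sprayOf g α x y := fun α =>
    (SmoothOver.const 2).mul (H.smooth_spray α)
  have hP : ∀ μ, SmoothOver U (dX μ (lowerY g κ)) := fun μ => (H.smooth_lowerY κ).dX H.isOpen μ
  have hL : SmoothOver U fun x y => (1 / 2) * dX κ (energy g) x y :=
    (SmoothOver.const _).mul (H.smooth_energy.dX H.isOpen κ)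
  have h := (H.isDY β).congr (fun x hx y hy => H.lower_spray hx hy κ) x hx y hy
  rw [(H.isDY β).sum_mul hx hy (H.smooth κ) hG,
    (H.isDY β).sub hx hy (.sum fun μ => (hP μ).mul (.fibreCoord μ)) hL,
    (H.isDY β).sum_mul hx hy hP .fibreCoord,
    (H.isDY β).const_mul hx hy _ (H.smooth_energy.dX H.isOpen κ),
    dY_dX_comm H.isOpen H.smooth_energy hx hy] at h
  have h1 : dX κ (dY β (energy g)) x y = 2 * dX κ (lowerY g β) x y := by
    rw [(H.isDX κ).congr (fun x hx y hy => H.dY_energy hx hy β) x hx y hy,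
      (H.isDX κ).const_mul hx hy _ (H.smooth_lowerY β)]
  have h2 : ∀ μ, dY β (dX μ (lowerY g κ)) x y = dX μ (g κ β) x y := fun μ => by
    rw [dY_dX_comm H.isOpen (H.smooth_lowerY κ) hx hy,
      (H.isDX μ).congr (fun x hx y hy => H.dY_lowerY hx hy β κ) x hx y hy]
  have h3 : ∀ α, dY β (fun x y => 2 * sprayOf g α x y) x y = 2 * barthelOf g α β x y := fun α =>
    (H.isDY β).const_mul hx hy _ (H.smooth_spray α)
  simp only [h1, h2, h3, dY_fibreCoord, mul_ite, mul_one, mul_zero, Finset.sum_ite_eq',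
    Finset.mem_univ, if_true, fibreCoord] at h
  rw [h]
  ring

/-- `N^α_β y^β = 2 G^α`: the spray is homogeneous of degree two. -/
lemma barthel_contract (α : Fin n) : ∑ β, barthelOf g α β x y * y β = 2 * sprayOf g α x y := by
  refine H.ext_of_lower hx hy (v := fun α => ∑ β, barthelOf g α β x y * y β)
    (w := fun α => 2 * sprayOf g α x y) (fun κ => ?_) α
  have h : ∑ β, (∑ α, dY β (g κ α) x y * (2 * sprayOf g α x y)
        + ∑ α, g κ α x y * (2 * barthelOf g α β x y)) * y β =
      ∑ β, (∑ μ, dX μ (g κ β) x y * y μ + dX β (lowerY g κ) x y - dX κ (lowerY g β) x y) * y β :=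
    Finset.sum_congr rfl fun β _ => by rw [H.lower_barthel hx hy κ β]
  have h1 : ∑ β, (∑ α, dY β (g κ α) x y * (2 * sprayOf g α x y)) * y β = 0 := by
    simp only [Finset.sum_mul]
    rw [Finset.sum_comm]
    refine Finset.sum_eq_zero fun α _ => ?_
    have := H.euler κ α x hx y hy
    simp only [mul_right_comm _ (2 * sprayOf g α x y), ← Finset.sum_mul]
    exact mul_eq_zero_of_left this _
  have h2 : ∑ β, (∑ α, g κ α x y * (2 * barthelOf g α β x y)) * y β =
      2 * ∑ α, g κ α x y * ∑ β, barthelOf g α β x y * y β := by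
    simp only [Finset.sum_mul, Finset.mul_sum]
    rw [Finset.sum_comm]
    refine Finset.sum_congr rfl fun μ _ => Finset.sum_congr rfl fun ν _ => ?_
    ring
  have h3 : ∑ β, (∑ μ, dX μ (g κ β) x y * y μ) * y β = ∑ β, dX β (lowerY g κ) x y * y β := by
    simp only [H.dX_lowerY hx hy, Finset.sum_mul]
    rw [Finset.sum_comm]
    refine Finset.sum_congr rfl fun μ _ => Finset.sum_congr rfl fun ν _ => ?_
    ring
  simp only [add_mul, sub_mul, Finset.sum_add_distrib, Finset.sum_sub_distrib, h1, h2, h3] at h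
  rw [H.lower_spray hx hy, H.dX_energy hx hy]
  simp only [fibreCoord]
  linarith

/-- `F^α_{μν} y^μ = N^α_ν` for the Cartan connection (vanishing deflection). -/
lemma F_contract (α ν : Fin n) : ∑ μ, (cartanOf g).F α μ ν x y * y μ = barthelOf g α ν x y := by
  refine H.ext_of_lower hx hy (v := fun α => ∑ μ, (cartanOf g).F α μ ν x y * y μ)
    (w := fun α => barthelOf g α ν x y) (fun κ => ?_) α
  -- the vertical part of `δ_ρ` drops out, because `y^μ ∂̇_α g_{μκ} = 0`
  have hδ : ∀ ρ κ, ∑ μ, delta (barthelOf g) ρ (g μ κ) x y * y μ = dX ρ (lowerY g κ) x y := by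
    intro ρ κ
    simp only [delta, sub_mul, Finset.sum_sub_distrib, H.dX_lowerY hx hy, Finset.sum_mul]
    rw [Finset.sum_comm]
    simp only [mul_assoc, ← Finset.mul_sum, H.dY_contract_left hx hy, mul_zero,
      Finset.sum_const_zero, sub_zero, H.d_symm hx hy (H.isDX ρ) _ κ]
  have hδ' : ∑ μ, delta (barthelOf g) μ (g ν κ) x y * y μ =
      ∑ μ, dX μ (g ν κ) x y * y μ - ∑ α, dY ν (g κ α) x y * (2 * sprayOf g α x y) := by
    simp only [delta, sub_mul, Finset.sum_sub_distrib, Finset.sum_mul,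
      ← H.barthel_contract hx hy, Finset.mul_sum]
    congr 1
    rw [Finset.sum_comm]
    refine Finset.sum_congr rfl fun α _ => Finset.sum_congr rfl fun μ _ => ?_
    rw [H.d_symm hx hy (H.isDY α) ν κ, H.dY_swap_right hx hy α κ ν]
    ring
  have h1 : ∑ α, g κ α x y * ∑ μ, (cartanOf g).F α μ ν x y * y μ =
      ∑ μ, (1 / 2) * (delta (barthelOf g) μ (g ν κ) x y + delta (barthelOf g) ν (g μ κ) x y
        - delta (barthelOf g) κ (g μ ν) x y) * y μ := by
    simp only [← H.lower_christoffel hx hy, Finset.mul_sum, Finset.sum_mul]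
    rw [Finset.sum_comm]
    simp only [cartanOf, mul_assoc]
  have h2 := H.lower_barthel hx hy κ ν
  have h3 : ∑ α, g κ α x y * (2 * barthelOf g α ν x y) =
      2 * ∑ α, g κ α x y * barthelOf g α ν x y := by
    simp only [Finset.mul_sum, mul_left_comm]
  rw [h1]
  simp only [mul_assoc, ← Finset.mul_sum, add_mul, sub_mul, Finset.sum_add_distrib,
    Finset.sum_sub_distrib, hδ, hδ']
  simp only [H.d_symm hx hy (H.isDX _) ν κ]
  linarith

end IsFinslerMetric

lemma Connection.hCov_tens12 (D : Connection n) (X : Fin n → Fin n → Fin n → Fld n)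
    (α μ ν β : Fin n) (x y : Coord n) :
    D.hCov (tens12 X) ![α] ![μ, ν] β x y = delta D.N β (X α μ ν) x y
      + ∑ η, X η μ ν x y * D.F α η β x y
      - (∑ η, X α η ν x y * D.F η μ β x y + ∑ η, X α μ η x y * D.F η ν β x y) := by
  simp [Connection.hCov, tens12, Fin.sum_univ_two]

namespace IsFinslerMetric

variable {U : Set (Coord n)} {g : Fin n → Fin n → Fld n} (H : IsFinslerMetric U g)
  {x y : Coord n} (hx : x ∈ U) (hy : y ≠ 0)
include H hx hy

/-! ### Torsion as the contraction of curvature -/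

/-- The `δ`-derivative of `y^μ F^α_{μν} = N^α_ν`, where `δ_σ y^μ = - N^μ_σ`. -/
lemma delta_F_contract (α ν σ : Fin n) :
    ∑ μ, delta (barthelOf g) σ ((cartanOf g).F α μ ν) x y * y μ =
      delta (barthelOf g) σ (barthelOf g α ν) x y
        + ∑ μ, (cartanOf g).F α μ ν x y * barthelOf g μ σ x y := by
  have h := (H.isDelta σ).congr (fun x hx y hy => H.F_contract hx hy α ν) x hx y hy
  have h' := (H.isDelta σ).sum_mul hx hy (fun μ => H.smooth_F α μ ν) .fibreCoord
  simp only [delta_fibreCoord, mul_neg, Finset.sum_neg_distrib] at h'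
  rw [← h]
  exact eq_add_of_sub_eq ((sub_eq_add_neg _ _).trans h'.symm)

lemma delta_C_contract (α ν σ : Fin n) :
    ∑ μ, delta (barthelOf g) σ ((cartanOf g).C α μ ν) x y * y μ =
      ∑ μ, (cartanOf g).C α μ ν x y * barthelOf g μ σ x y := by
  have h := (H.isDelta σ).congr (h := fun _ _ => 0)
    (fun x hx y hy => H.C_contract hx hy α ν) x hx y hy
  have h' := (H.isDelta σ).sum_mul hx hy (fun μ => H.smooth_C α μ ν) .fibreCoord
  simp only [delta_fibreCoord, mul_neg, Finset.sum_neg_distrib] at h'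
  rw [(H.isDelta σ).const 0 x hx y hy] at h
  have := h'.symm.trans h
  simp only [fibreCoord] at this
  linarith

/-- The vertical derivative of `y^μ F^α_{μν} = N^α_ν`. -/
lemma dY_F_contract (α ν σ : Fin n) :
    ∑ μ, dY σ ((cartanOf g).F α μ ν) x y * y μ = (cartanOf g).torsionP α ν σ x y := by
  have h := (H.isDY σ).congr (fun x hx y hy => H.F_contract hx hy α ν) x hx y hy
  have h' := (H.isDY σ).sum_mul hx hy (fun μ => H.smooth_F α μ ν) .fibreCoord
  simp only [dY_fibreCoord, mul_ite, mul_one, mul_zero, Finset.sum_ite_eq', Finset.mem_univ,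
    if_true] at h'
  have h2 := h'.symm.trans h
  simp only [fibreCoord] at h2
  rw [H.F_symm hx hy] at h2
  exact eq_sub_of_add_eq h2

/-- Contracting the `h`-curvature of the Cartan connection with `y` gives its `(v)h`-torsion. -/
lemma curvR_contract (α ν σ : Fin n) :
    ∑ μ, (cartanOf g).curvR α μ ν σ x y * y μ = (cartanOf g).torsionR α ν σ x y := by
  have hF : ∀ ν σ, ∑ μ, (∑ η, (cartanOf g).F η μ ν x y * (cartanOf g).F α η σ x y) * y μ =
      ∑ η, (cartanOf g).F α η σ x y * barthelOf g η ν x y := fun ν σ => by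
    simp only [Finset.sum_mul, ← H.F_contract hx hy, Finset.mul_sum]
    rw [Finset.sum_comm]
    refine Finset.sum_congr rfl fun μ _ => Finset.sum_congr rfl fun ν _ => ?_
    ring
  have hC : ∑ μ, (∑ η, (cartanOf g).C α μ η x y * (cartanOf g).torsionR η ν σ x y) * y μ = 0 := by
    simp only [Finset.sum_mul]
    rw [Finset.sum_comm]
    refine Finset.sum_eq_zero fun η _ => ?_
    simp only [mul_right_comm _ ((cartanOf g).torsionR η ν σ x y), ← Finset.sum_mul,
      H.C_contract hx hy, zero_mul]
  simp only [Connection.curvR, add_mul, sub_mul, Finset.sum_add_distrib, Finset.sum_sub_distrib,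
    hF, hC]
  have h1 := H.delta_F_contract hx hy α ν σ
  have h2 := H.delta_F_contract hx hy α σ ν
  simp only [Connection.torsionR]
  change ∑ μ, delta (cartanOf g).N σ ((cartanOf g).F α μ ν) x y * y μ = _ at h1
  change ∑ μ, delta (cartanOf g).N ν ((cartanOf g).F α μ σ) x y * y μ = _ at h2
  rw [h1, h2]
  simp only [cartanOf]
  ring

lemma hCov_C_contract (α σ ν : Fin n) :
    ∑ μ, (cartanOf g).hCov (tens12 (cartanOf g).C) ![α] ![μ, σ] ν x y * y μ = 0 := by
  have h1 : ∑ μ, (∑ η, (cartanOf g).C η μ σ x y * (cartanOf g).F α η ν x y) * y μ = 0 := by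
    simp only [Finset.sum_mul]
    rw [Finset.sum_comm]
    refine Finset.sum_eq_zero fun η _ => ?_
    simp only [mul_right_comm _ ((cartanOf g).F α η ν x y), ← Finset.sum_mul,
      H.C_contract hx hy, zero_mul]
  have h2 : ∑ μ, (∑ η, (cartanOf g).C α μ η x y * (cartanOf g).F η σ ν x y) * y μ = 0 := by
    simp only [Finset.sum_mul]
    rw [Finset.sum_comm]
    refine Finset.sum_eq_zero fun η _ => ?_
    simp only [mul_right_comm _ ((cartanOf g).F η σ ν x y), ← Finset.sum_mul,
      H.C_contract hx hy, zero_mul]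
  have h3 : ∑ μ, (∑ η, (cartanOf g).C α η σ x y * (cartanOf g).F η μ ν x y) * y μ =
      ∑ η, (cartanOf g).C α η σ x y * barthelOf g η ν x y := by
    simp only [Finset.sum_mul, ← H.F_contract hx hy, Finset.mul_sum]
    rw [Finset.sum_comm]
    simp only [mul_assoc]
  have h4 := H.delta_C_contract hx hy α σ ν
  change ∑ μ, delta (cartanOf g).N ν ((cartanOf g).C α μ σ) x y * y μ = _ at h4
  simp only [Connection.hCov_tens12, add_mul, sub_mul, Finset.sum_add_distrib,
    Finset.sum_sub_distrib, h1, h2, h3, h4]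
  ring

/-- Contracting the `hv`-curvature of the Cartan connection with `y` gives its
`(v)hv`-torsion. -/
lemma curvP_contract (α ν σ : Fin n) :
    ∑ μ, (cartanOf g).curvP α μ ν σ x y * y μ = (cartanOf g).torsionP α ν σ x y := by
  have hC : ∑ μ, (∑ η, (cartanOf g).C α μ η x y * (cartanOf g).torsionP η ν σ x y) * y μ = 0 := by
    simp only [Finset.sum_mul]
    rw [Finset.sum_comm]
    refine Finset.sum_eq_zero fun η _ => ?_
    simp only [mul_right_comm _ ((cartanOf g).torsionP η ν σ x y), ← Finset.sum_mul,
      H.C_contract hx hy, zero_mul]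
  simp only [Connection.curvP, add_mul, sub_mul, Finset.sum_add_distrib, Finset.sum_sub_distrib,
    hC, H.hCov_C_contract hx hy, H.dY_F_contract hx hy]
  ring

/-! ### Horizontally constant Cartan tensor -/

/-- The vertical derivative of `N^α_μ y^μ = 2 G^α` gives `y^μ ∂̇_σ N^α_μ = N^α_σ`, which is also
`y^μ F^α_{μσ}`. -/
lemma torsionP_contract (α σ : Fin n) : ∑ μ, (cartanOf g).torsionP α μ σ x y * y μ = 0 := by
  have h := (H.isDY σ).congr (fun x hx y hy => H.barthel_contract hx hy α) x hx y hy
  have h' := (H.isDY σ).sum_mul hx hy (fun μ => H.smooth_barthel α μ) .fibreCoord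
  rw [(H.isDY σ).const_mul hx hy _ (H.smooth_spray α)] at h
  simp only [dY_fibreCoord, mul_ite, mul_one, mul_zero, Finset.sum_ite_eq', Finset.mem_univ,
    if_true] at h'
  have h2 := h'.symm.trans h
  simp only [Connection.torsionP, sub_mul, Finset.sum_sub_distrib, H.F_contract hx hy]
  change _ = 2 * barthelOf g α σ x y at h2
  simp only [fibreCoord] at h2
  simp only [cartanOf]
  linarith

/-- The Cartan connection is horizontally metrical: `δ_β g_{μν} = F_{νμβ} + F_{μνβ}`. -/
lemma delta_metric (β μ ν : Fin n) :
    delta (barthelOf g) β (g μ ν) x y = ∑ α, g ν α x y * (cartanOf g).F α μ β x y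
      + ∑ α, g μ α x y * (cartanOf g).F α ν β x y := by
  simp only [cartanOf, H.lower_christoffel hx hy, H.d_symm hx hy (H.isDelta _) ν μ,
    H.d_symm hx hy (H.isDelta _) β]
  ring

/-- `g_{κα} C^α_{μν|β} = ½ (∂̇_κ g_{μν})_{|β}`: lowering an index commutes with the horizontal
covariant derivative, as the Cartan connection is horizontally metrical. -/
lemma lower_hCov_C (κ μ ν β : Fin n) :
    delta (barthelOf g) β (dY κ (g μ ν)) x y =
      2 * ∑ α, g κ α x y * (cartanOf g).hCov (tens12 (cartanOf g).C) ![α] ![μ, ν] β x y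
      + ∑ η, (cartanOf g).F η κ β x y * dY η (g μ ν) x y
      + ∑ η, (cartanOf g).F η μ β x y * dY κ (g η ν) x y
      + ∑ η, (cartanOf g).F η ν β x y * dY κ (g μ η) x y := by
  have h := (H.isDelta β).congr (fun x hx y hy => H.lower_C hx hy κ μ ν) x hx y hy
  rw [(H.isDelta β).sum_mul hx hy (H.smooth κ) (fun α => H.smooth_C α μ ν),
    (H.isDelta β).const_mul hx hy _ ((H.smooth μ ν).dY H.isOpen κ)] at h
  have h1 : ∑ α, (∑ η, g α η x y * (cartanOf g).F η κ β x y) * (cartanOf g).C α μ ν x y =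
      (1 / 2) * ∑ η, (cartanOf g).F η κ β x y * dY η (g μ ν) x y := by
    simp only [Finset.sum_mul]
    rw [Finset.sum_comm, Finset.mul_sum]
    refine Finset.sum_congr rfl fun η _ => ?_
    rw [mul_left_comm, ← H.lower_C hx hy, Finset.mul_sum]
    refine Finset.sum_congr rfl fun α _ => ?_
    rw [H.symm α η x hx y hy]
    ring
  have h2 : ∑ α, (∑ η, g κ η x y * (cartanOf g).F η α β x y) * (cartanOf g).C α μ ν x y =
      ∑ α, g κ α x y * ∑ η, (cartanOf g).C η μ ν x y * (cartanOf g).F α η β x y := by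
    simp only [Finset.sum_mul, Finset.mul_sum]
    rw [Finset.sum_comm]
    refine Finset.sum_congr rfl fun μ _ => Finset.sum_congr rfl fun ν _ => ?_
    ring
  have h3 : ∑ α, g κ α x y * ∑ η, (cartanOf g).C α η ν x y * (cartanOf g).F η μ β x y =
      (1 / 2) * ∑ η, (cartanOf g).F η μ β x y * dY κ (g η ν) x y := by
    simp only [Finset.mul_sum]
    rw [Finset.sum_comm]
    refine Finset.sum_congr rfl fun η _ => ?_
    rw [mul_left_comm, ← H.lower_C hx hy, Finset.mul_sum]
    refine Finset.sum_congr rfl fun α _ => ?_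
    ring
  have h4 : ∑ α, g κ α x y * ∑ η, (cartanOf g).C α μ η x y * (cartanOf g).F η ν β x y =
      (1 / 2) * ∑ η, (cartanOf g).F η ν β x y * dY κ (g μ η) x y := by
    simp only [Finset.mul_sum]
    rw [Finset.sum_comm]
    refine Finset.sum_congr rfl fun η _ => ?_
    rw [mul_left_comm, ← H.lower_C hx hy, Finset.mul_sum]
    refine Finset.sum_congr rfl fun α _ => ?_
    ring
  simp only [Connection.hCov_tens12, mul_add, mul_sub, Finset.sum_add_distrib,
    Finset.sum_sub_distrib, h3, h4, ← h2]
  simp only [H.delta_metric hx hy, add_mul, Finset.sum_add_distrib, h1] at h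
  simp only [show (cartanOf g).N = barthelOf g from rfl]
  linarith

/-- The vertical derivative of the metricity equation `δ_β g_{μν} = F_{νμβ} + F_{μνβ}` when the
Cartan tensor is horizontally constant: only the `(v)hv`-torsion, which comes from the commutator
of `∂̇_σ` and `δ_β`, survives. -/
lemma lower_dY_F_add
    (hC : ∀ α μ ν β, (cartanOf g).hCov (tens12 (cartanOf g).C) ![α] ![μ, ν] β x y = 0)
    (μ ν β σ : Fin n) :
    ∑ α, g ν α x y * dY σ ((cartanOf g).F α μ β) x y
      + ∑ α, g μ α x y * dY σ ((cartanOf g).F α ν β) x y =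
      - ∑ α, (cartanOf g).torsionP α β σ x y * dY α (g μ ν) x y := by
  have h := (H.isDY σ).congr (fun x hx y hy => H.delta_metric hx hy β μ ν) x hx y hy
  rw [(H.isDY σ).add (.sum fun α => (H.smooth ν α).mul (H.smooth_F α μ β))
    (.sum fun α => (H.smooth μ α).mul (H.smooth_F α ν β)) x hx y hy] at h
  simp only [(H.isDY σ).sum_mul hx hy (H.smooth ν) (fun α => H.smooth_F α μ β),
    (H.isDY σ).sum_mul hx hy (H.smooth μ) (fun α => H.smooth_F α ν β)] at h
  rw [dY_delta H.isOpen H.smooth_barthel (H.smooth μ ν) hx hy, H.lower_hCov_C hx hy] at h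
  simp only [hC, mul_zero, Finset.sum_const_zero, zero_add] at h
  simp only [H.d_symm hx hy (H.isDY σ) ν, mul_comm ((cartanOf g).F _ μ β x y),
    mul_comm ((cartanOf g).F _ ν β x y)] at h
  simp only [Connection.torsionP, sub_mul, Finset.sum_sub_distrib, H.F_symm hx hy _ β σ]
  simp only [show (cartanOf g).N = barthelOf g from rfl]
  linarith

/-- The Christoffel trick applied to `lower_dY_F_add`. -/
lemma two_lower_dY_F
    (hC : ∀ α μ ν β, (cartanOf g).hCov (tens12 (cartanOf g).C) ![α] ![μ, ν] β x y = 0)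
    (μ ν β σ : Fin n) :
    2 * ∑ α, g ν α x y * dY σ ((cartanOf g).F α μ β) x y =
      - ∑ α, (cartanOf g).torsionP α β σ x y * dY α (g μ ν) x y
      - ∑ α, (cartanOf g).torsionP α μ σ x y * dY α (g β ν) x y
      + ∑ α, (cartanOf g).torsionP α ν σ x y * dY α (g μ β) x y := by
  have hs : ∀ κ μ β, ∑ α, g κ α x y * dY σ ((cartanOf g).F α μ β) x y =
      ∑ α, g κ α x y * dY σ ((cartanOf g).F α β μ) x y := fun κ μ β =>
    Finset.sum_congr rfl fun α _ => by
      rw [(H.isDY σ).congr (fun x hx y hy => H.F_symm hx hy α μ β) x hx y hy]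
  -- cyclic instances of the symmetrized equation; `∂̇_σ F^α_{μβ}` is symmetric in `μ, β`
  have h1 := H.lower_dY_F_add hx hy hC μ ν β σ
  have h2 := H.lower_dY_F_add hx hy hC β ν μ σ
  have h3 := H.lower_dY_F_add hx hy hC μ β ν σ
  rw [hs ν β μ, hs β ν μ] at h2
  rw [hs μ β ν] at h3
  linarith

/-- A Finsler metric with horizontally constant Cartan tensor is a Landsberg metric. -/
lemma torsionP_eq_zero_of_hCov_C
    (hC : ∀ α μ ν β, (cartanOf g).hCov (tens12 (cartanOf g).C) ![α] ![μ, ν] β x y = 0)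
    (α β σ : Fin n) : (cartanOf g).torsionP α β σ x y = 0 := by
  refine H.ext_of_lower hx hy (v := fun α => (cartanOf g).torsionP α β σ x y)
    (w := fun _ => 0) (fun κ => ?_) α
  -- contract `two_lower_dY_F` with `y^μ`: every term on the right vanishes
  have h : ∑ μ, (2 * ∑ α, g κ α x y * dY σ ((cartanOf g).F α μ β) x y) * y μ =
      ∑ μ, (- ∑ α, (cartanOf g).torsionP α β σ x y * dY α (g μ κ) x y
      - ∑ α, (cartanOf g).torsionP α μ σ x y * dY α (g β κ) x y
      + ∑ α, (cartanOf g).torsionP α κ σ x y * dY α (g μ β) x y) * y μ :=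
    Finset.sum_congr rfl fun μ _ => by rw [H.two_lower_dY_F hx hy hC]
  have h1 : ∑ μ, (2 * ∑ α, g κ α x y * dY σ ((cartanOf g).F α μ β) x y) * y μ =
      2 * ∑ α, g κ α x y * (cartanOf g).torsionP α β σ x y := by
    simp only [← H.dY_F_contract hx hy, Finset.sum_mul, Finset.mul_sum]
    rw [Finset.sum_comm]
    refine Finset.sum_congr rfl fun μ _ => Finset.sum_congr rfl fun ν _ => ?_
    ring
  have h2 : ∀ κ β, ∑ μ, (∑ α, (cartanOf g).torsionP α β σ x y * dY α (g μ κ) x y) * y μ = 0 := by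
    intro κ β
    simp only [Finset.sum_mul]
    rw [Finset.sum_comm]
    simp only [mul_assoc, ← Finset.mul_sum, H.dY_contract_left hx hy, mul_zero,
      Finset.sum_const_zero]
  have h3 : ∑ μ, (∑ α, (cartanOf g).torsionP α μ σ x y * dY α (g β κ) x y) * y μ = 0 := by
    simp only [Finset.sum_mul]
    rw [Finset.sum_comm]
    refine Finset.sum_eq_zero fun α _ => ?_
    simp only [mul_right_comm _ (dY α (g β κ) x y), ← Finset.sum_mul, H.torsionP_contract hx hy,
      zero_mul]
  simp only [add_mul, sub_mul, neg_mul, Finset.sum_add_distrib, Finset.sum_sub_distrib,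
    Finset.sum_neg_distrib, h2, h3, h1] at h
  simp only [mul_zero, Finset.sum_const_zero]
  linarith

/-- A Finsler metric with horizontally constant Cartan tensor is a Berwald metric: the horizontal
coefficients of the Cartan connection do not depend on `y`. -/
lemma dY_F_eq_zero_of_hCov_C
    (hC : ∀ α μ ν β, (cartanOf g).hCov (tens12 (cartanOf g).C) ![α] ![μ, ν] β x y = 0)
    (α μ β σ : Fin n) : dY σ ((cartanOf g).F α μ β) x y = 0 := by
  refine H.ext_of_lower hx hy (v := fun α => dY σ ((cartanOf g).F α μ β) x y)
    (w := fun _ => 0) (fun κ => ?_) α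
  have h := H.two_lower_dY_F hx hy hC μ κ β σ
  simp only [H.torsionP_eq_zero_of_hCov_C hx hy hC, zero_mul, Finset.sum_const_zero] at h
  simp only [mul_zero, Finset.sum_const_zero]
  linarith

lemma curvP_eq_zero_of_hCov_C
    (hC : ∀ α μ ν β, (cartanOf g).hCov (tens12 (cartanOf g).C) ![α] ![μ, ν] β x y = 0)
    (α μ ν σ : Fin n) : (cartanOf g).curvP α μ ν σ x y = 0 := by
  simp [Connection.curvP, hC, H.dY_F_eq_zero_of_hCov_C hx hy hC,
    H.torsionP_eq_zero_of_hCov_C hx hy hC]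

/-! ### Vanishing of torsion and curvature -/

lemma torsionR_eq_zero_of_curvR (hR : ∀ α μ ν σ, (cartanOf g).curvR α μ ν σ x y = 0)
    (α ν σ : Fin n) : (cartanOf g).torsionR α ν σ x y = 0 := by
  simp [← H.curvR_contract hx hy, hR]

lemma torsionP_eq_zero_of_curvP (hP : ∀ α μ ν σ, (cartanOf g).curvP α μ ν σ x y = 0)
    (α ν σ : Fin n) : (cartanOf g).torsionP α ν σ x y = 0 := by
  simp [← H.curvP_contract hx hy, hP]

lemma berwald_torsionT (α μ ν : Fin n) : (berwaldOf g).torsionT α μ ν x y = 0 :=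
  sub_eq_zero_of_eq (dY_dY_comm H.isOpen (H.smooth_spray α) hx hy ν μ)

omit hx hy in
/-- For a Landsberg metric the Berwald and the Cartan connection have the same horizontal
coefficients. -/
lemma berwald_F_eq
    (hP : ∀ x ∈ U, ∀ y, y ≠ 0 → ∀ α μ ν σ, (cartanOf g).curvP α μ ν σ x y = 0) (α μ ν : Fin n) :
    EqOver U ((berwaldOf g).F α μ ν) ((cartanOf g).F α μ ν) := fun x hx y hy =>
  sub_eq_zero.1 (H.torsionP_eq_zero_of_curvP hx hy (hP x hx y hy) α μ ν)

lemma berwald_curvR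
    (hP : ∀ x ∈ U, ∀ y, y ≠ 0 → ∀ α μ ν σ, (cartanOf g).curvP α μ ν σ x y = 0)
    (hR : ∀ α μ ν σ, (cartanOf g).curvR α μ ν σ x y = 0) (α μ ν σ : Fin n) :
    (berwaldOf g).curvR α μ ν σ x y = 0 := by
  have h := hR α μ ν σ
  simp only [Connection.curvR, H.torsionR_eq_zero_of_curvR hx hy hR, mul_zero,
    Finset.sum_const_zero, add_zero] at h
  have hd : ∀ σ ν, delta (berwaldOf g).N σ ((berwaldOf g).F α μ ν) x y =
      delta (cartanOf g).N σ ((cartanOf g).F α μ ν) x y := fun σ ν =>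
    (H.isDelta σ).congr (H.berwald_F_eq hP α μ ν) x hx y hy
  simp only [Connection.curvR, hd, H.berwald_F_eq hP _ _ _ x hx y hy, h]
  simp [berwaldOf]

lemma berwald_curvP
    (hP : ∀ x ∈ U, ∀ y, y ≠ 0 → ∀ α μ ν σ, (cartanOf g).curvP α μ ν σ x y = 0)
    (α μ ν σ : Fin n) : (berwaldOf g).curvP α μ ν σ x y =
      (cartanOf g).hCov (tens12 (cartanOf g).C) ![α] ![μ, σ] ν x y := by
  have h := hP x hx y hy α μ ν σ
  simp only [Connection.curvP, H.torsionP_eq_zero_of_curvP hx hy (hP x hx y hy), mul_zero,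
    Finset.sum_const_zero, add_zero] at h
  have h1 : (berwaldOf g).hCov (tens12 (berwaldOf g).C) ![α] ![μ, σ] ν x y = 0 := by
    rw [Connection.hCov_tens12]
    have : delta (berwaldOf g).N ν ((berwaldOf g).C α μ σ) x y = 0 :=
      (H.isDelta ν).const 0 x hx y hy
    simp only [this]
    simp [berwaldOf]
  simp only [Connection.curvP, h1, (H.isDY σ).congr (H.berwald_F_eq hP α μ ν) x hx y hy]
  rw [← sub_eq_zero.1 h]
  simp [berwaldOf]

omit hx hy H in
lemma berwald_curvS (α μ ν σ : Fin n) : (berwaldOf g).curvS α μ ν σ x y = 0 := by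
  simp [Connection.curvS, berwaldOf, dY]

end IsFinslerMetric

/-! ### The metric of a parallelization -/

lemma IsFinslerMetric.congr {U : Set (Coord n)} {g h : Fin n → Fin n → Fld n}
    (H : IsFinslerMetric U g) (e : ∀ μ ν, EqOver U (h μ ν) (g μ ν)) : IsFinslerMetric U h where
  isOpen := H.isOpen
  smooth μ ν := (H.smooth μ ν).congr (e μ ν)
  symm μ ν x hx y hy := by rw [e μ ν x hx y hy, e ν μ x hx y hy, H.symm μ ν x hx y hy]
  det_ne_zero x hx y hy := by
    simpa only [e _ _ x hx y hy] using H.det_ne_zero x hx y hy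
  total_symm α μ ν x hx y hy := by
    rw [(H.isDY α).congr (e μ ν) x hx y hy, (H.isDY μ).congr (e α ν) x hx y hy,
      H.total_symm α μ ν x hx y hy]
  euler μ ν x hx y hy := by
    simp only [(H.isDY _).congr (e μ ν) x hx y hy]
    exact H.euler μ ν x hx y hy

lemma christoffel_congr {U : Set (Coord n)} {g h : Fin n → Fin n → Fld n}
    {d : Fin n → Fld n → Fld n} (hd : ∀ μ, IsDerivationOver U (d μ))
    (e : ∀ μ ν, EqOver U (h μ ν) (g μ ν)) (α μ ν : Fin n) :
    EqOver U (christoffel d h α μ ν) (christoffel d g α μ ν) := fun x hx y hy => by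
  simp only [christoffel, inverse, (hd _).congr (e _ _) x hx y hy, e _ _ x hx y hy]

lemma sum_dY_mul_eq_fderiv (f : Fld n) (x y : Coord n) :
    ∑ α, dY α f x y * y α = fderiv ℝ (fun y' => f x y') y y := by
  have hy : ∑ α, y α • EuclideanSpace.single α (1 : ℝ) = y := by
    ext β
    simp [Finset.sum_apply, Pi.single_apply]
  conv_rhs => arg 2; rw [← hy]
  simp [map_sum, dY, mul_comm]

/-- Euler's identity for functions that are positively homogeneous of degree `0` in `y`. -/
lemma euler_of_homogeneous {U : Set (Coord n)} (hU : IsOpen U) {f : Fld n} (hf : SmoothOver U f)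
    {x y : Coord n} (hx : x ∈ U) (hy : y ≠ 0) (h : ∀ a : ℝ, 0 < a → f x (a • y) = f x y) :
    ∑ α, dY α f x y * y α = 0 := by
  rw [sum_dY_mul_eq_fderiv]
  have h1 : HasDerivAt (fun a : ℝ => a • y) y 1 := by
    simpa using (hasDerivAt_id (1 : ℝ)).smul_const y
  have h2 : HasFDerivAt (fun y' => f x y') (fderiv ℝ (fun y' => f x y') y) ((1 : ℝ) • y) := by
    rw [one_smul]
    exact (hf.differentiableAt_snd hU hx hy).hasFDerivAt
  have h3 := h2.comp_hasDerivAt (1 : ℝ) h1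
  have h4 : HasDerivAt ((fun y' => f x y') ∘ fun a : ℝ => a • y) 0 1 := by
    refine (hasDerivAt_const (1 : ℝ) (f x y)).congr_of_eventuallyEq ?_
    filter_upwards [lt_mem_nhds (zero_lt_one (α := ℝ))] with a ha using h a ha
  exact h3.unique h4

namespace FPSpace

variable {M : Type*} [TopologicalSpace M] [ChartedSpace (Coord n) M]
  [IsManifold 𝓘(ℝ, Coord n) ∞ M] (S : FPSpace n M) {e : OpenPartialHomeomorph M (Coord n)}
  (he : e ∈ IsManifold.maximalAtlas 𝓘(ℝ, Coord n) ∞ M)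
include he

omit S [IsManifold 𝓘(ℝ, Coord n) ∞ M] in
lemma mdifferentiable_chart :
    e.MDifferentiable 𝓘(ℝ, Coord n) 𝓘(ℝ, Coord n) :=
  ⟨(contMDiffOn_of_mem_maximalAtlas he).mdifferentiableOn (by simp),
    (contMDiffOn_symm_of_mem_maximalAtlas he).mdifferentiableOn (by simp)⟩

omit S [IsManifold 𝓘(ℝ, Coord n) ∞ M] in
lemma mfderiv_symm_ne_zero {x y : Coord n} (hx : x ∈ e.target) (hy : y ≠ 0) :
    mfderiv 𝓘(ℝ, Coord n) 𝓘(ℝ, Coord n) e.symm x y ≠ 0 := fun h =>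
  hy ((mdifferentiable_chart he).symm.mfderiv_injective hx (h.trans (map_zero _).symm))

/-- The matrix `(λ_i^α)` is invertible. -/
lemma isUnit_frame {x y : Coord n} (hx : x ∈ e.target) (hy : y ≠ 0) :
    IsUnit (Matrix.of fun α j => frame S.lam e j α x y) := by
  have hli := S.independent (e.symm x) _ (mfderiv_symm_ne_zero he hx hy)
  have h2 : LinearIndependent ℝ fun i => (show Coord n from
      mfderiv 𝓘(ℝ, Coord n) 𝓘(ℝ, Coord n) e (e.symm x)
        (S.lam i (e.symm x) (mfderiv 𝓘(ℝ, Coord n) 𝓘(ℝ, Coord n) e.symm x y))) :=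
    hli.map' (mfderiv 𝓘(ℝ, Coord n) 𝓘(ℝ, Coord n) e (e.symm x)).toLinearMap
      (LinearMap.ker_eq_bot.2 ((mdifferentiable_chart he).mfderiv_injective (e.map_target hx)))
  have h3 := h2.map' (WithLp.linearEquiv 2 ℝ (Fin n → ℝ)).toLinearMap (LinearEquiv.ker _)
  exact Matrix.linearIndependent_cols_iff_isUnit.1 h3

lemma sum_frame_mul_coframe {x y : Coord n} (hx : x ∈ e.target) (hy : y ≠ 0) (α η : Fin n) :
    ∑ i, frame S.lam e i α x y * coframe S.lam e i η x y = if α = η then 1 else 0 := by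
  have h := Matrix.mul_nonsing_inv _ ((Matrix.isUnit_iff_isUnit_det _).1 (S.isUnit_frame he hx hy))
  have := congrFun (congrFun h α) η
  rw [Matrix.mul_apply, Matrix.one_apply] at this
  exact this

lemma smooth_coframe (i μ : Fin n) : SmoothOver e.target (coframe S.lam e i μ) :=
  smoothOver_inv (fun α j => S.smooth e he j α) (fun _ hx _ hy =>
    ((Matrix.isUnit_iff_isUnit_det _).1 (S.isUnit_frame he hx hy)).ne_zero) i μ

lemma smooth_frameMetric (μ ν : Fin n) : SmoothOver e.target (frameMetric S.lam e μ ν) :=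
  .sum fun i => (S.smooth_coframe he i μ).mul (S.smooth_coframe he i ν)

lemma frameMetric_smul {x y : Coord n} (hx : x ∈ e.target) (hy : y ≠ 0) {a : ℝ} (ha : 0 < a)
    (μ ν : Fin n) : frameMetric S.lam e μ ν x (a • y) = frameMetric S.lam e μ ν x y := by
  have h : ∀ i α, frame S.lam e i α x (a • y) = frame S.lam e i α x y := fun i α => by
    have := S.homogeneous i (e.symm x) _ (mfderiv_symm_ne_zero he hx hy) a ha
    have hs := ContinuousLinearMap.map_smul (mfderiv 𝓘(ℝ, Coord n) 𝓘(ℝ, Coord n) e.symm x) a y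
    exact congrArg (fun w : TangentSpace 𝓘(ℝ, Coord n) (e.symm x) =>
      (show Coord n from mfderiv 𝓘(ℝ, Coord n) 𝓘(ℝ, Coord n) e (e.symm x) w) α)
      ((congrArg (S.lam i (e.symm x)) hs).trans this)
  simp only [frameMetric, coframe, h]

lemma det_frameMetric_ne_zero {x y : Coord n} (hx : x ∈ e.target) (hy : y ≠ 0) :
    (Matrix.of fun μ ν => frameMetric S.lam e μ ν x y).det ≠ 0 := by
  have h : (Matrix.of fun μ ν => frameMetric S.lam e μ ν x y) =
      (Matrix.of fun α j => frame S.lam e j α x y)⁻¹.transpose *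
        (Matrix.of fun α j => frame S.lam e j α x y)⁻¹ := by
    ext μ ν
    rfl
  have hu : ((Matrix.of fun α j => frame S.lam e j α x y)⁻¹).det ≠ 0 :=
    ((Matrix.isUnit_iff_isUnit_det _).1
      ((Matrix.isUnit_nonsing_inv_iff).2 (S.isUnit_frame he hx hy))).ne_zero
  rw [h, Matrix.det_mul, Matrix.det_transpose]
  exact mul_ne_zero hu hu

lemma isFinslerMetric_frameMetric : IsFinslerMetric e.target (frameMetric S.lam e) where
  isOpen := e.open_target
  smooth := S.smooth_frameMetric he
  symm μ ν x _ y _ := by simp only [frameMetric, mul_comm]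
  det_ne_zero x hx y hy := S.det_frameMetric_ne_zero he hx hy
  total_symm α μ ν x hx y hy := S.totally_symmetric e he x hx y hy α μ ν
  euler μ ν x hx y hy := euler_of_homogeneous e.open_target (S.smooth_frameMetric he μ ν) hx hy
    fun _ ha => S.frameMetric_smul he hx hy ha μ ν

/-! ### The Finsler structure -/

omit he in
/-- `F² = g_{μν} y^μ y^ν`; the radicand is a sum of squares, so the square root loses nothing. -/
lemma finsler_sq (x y : Coord n) :
    S.finsler e x y ^ 2 = energy (frameMetric S.lam e) x y := by
  have h : ∑ μ, ∑ ν, frameMetric S.lam e μ ν x y * y μ * y ν =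
      ∑ i, (∑ μ, coframe S.lam e i μ x y * y μ) ^ 2 := by
    simp only [frameMetric, sq, Finset.sum_mul, Finset.mul_sum]
    rw [Finset.sum_comm_cycle]
    refine Finset.sum_congr rfl fun i _ => Finset.sum_congr rfl fun μ _ =>
      Finset.sum_congr rfl fun ν _ => ?_
    ring
  rw [finsler, Real.sq_sqrt (by rw [h]; positivity)]
  simp only [energy, lowerY, fibreCoord, Finset.sum_mul]
  refine Finset.sum_congr rfl fun μ _ => Finset.sum_congr rfl fun ν _ => ?_
  ring

/-- The Finsler metric `½ ∂̇_μ ∂̇_ν F²` is the metric of the parallelization. -/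
lemma finslerMetric_eq (μ ν : Fin n) :
    EqOver e.target (S.finslerMetric e μ ν) (frameMetric S.lam e μ ν) := by
  intro x hx y hy
  have H := S.isFinslerMetric_frameMetric he
  simp only [finslerMetric]
  rw [show (fun x' y' => S.finsler e x' y' ^ 2) = energy (frameMetric S.lam e) from
      funext₂ S.finsler_sq,
    (H.isDY μ).congr (fun x hx y hy => H.dY_energy hx hy ν) x hx y hy,
    (H.isDY μ).const_mul hx hy 2 (H.smooth_lowerY ν), H.dY_lowerY hx hy,
    H.symm ν μ x hx y hy]
  ring

lemma isFinslerMetric : IsFinslerMetric e.target (S.finslerMetric e) :=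
  (S.isFinslerMetric_frameMetric he).congr (S.finslerMetric_eq he)

lemma cartanTensor_eq {x y : Coord n} (hx : x ∈ e.target) (hy : y ≠ 0) (β μ ν : Fin n) :
    S.cartanTensor e β μ ν x y = (1 / 2) * dY β (S.finslerMetric e μ ν) x y := by
  have H := S.isFinslerMetric he
  have h : dY μ (dY ν fun x' y' => S.finsler e x' y' ^ 2) =
      fun x y => 2 * S.finslerMetric e μ ν x y := by
    funext x y
    simp only [finslerMetric]
    ring
  rw [cartanTensor, h, (H.isDY β).const_mul hx hy 2 (H.smooth μ ν)]
  ring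

/-! ### Vertical coefficients -/

lemma cartan_C_eq {x y : Coord n} (hx : x ∈ e.target) (hy : y ≠ 0) (α μ ν : Fin n) :
    (S.cartan e).C α μ ν x y =
      ∑ η, inverse (S.finslerMetric e) α η x y * S.cartanTensor e η μ ν x y := by
  have H := S.isFinslerMetric he
  simp only [cartan, christoffel, S.cartanTensor_eq he hx hy, Finset.mul_sum]
  refine Finset.sum_congr rfl fun η _ => ?_
  rw [H.total_symm μ ν η x hx y hy, H.dY_swap_right hx hy ν μ η]
  ring

lemma miron_C_eq {x y : Coord n} (hx : x ∈ e.target) (hy : y ≠ 0) (α μ ν : Fin n) :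
    (S.miron e).C α μ ν x y =
      ∑ η, inverse (S.finslerMetric e) α η x y * S.cartanTensor e η μ ν x y :=
  (christoffel_congr (S.isFinslerMetric he).isDY (S.finslerMetric_eq he) α μ ν x hx y hy).symm.trans
    (S.cartan_C_eq he hx hy α μ ν)

lemma canonical_C_eq {x y : Coord n} (hx : x ∈ e.target) (hy : y ≠ 0) (α μ ν : Fin n) :
    (S.canonical e).C α μ ν x y =
      ∑ i, frame S.lam e i α x y * dY ν (coframe S.lam e i μ) x y := by
  have h : ∀ i, (S.miron e).vCov (tens01 (coframe S.lam e i)) ![] ![μ] ν x y =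
      dY ν (coframe S.lam e i μ) x y -
        ∑ η, coframe S.lam e i η x y * (S.miron e).C η μ ν x y := fun i => by
    simp [Connection.vCov, vDeriv, tens01]
  have h2 : ∑ i, frame S.lam e i α x y *
      ∑ η, coframe S.lam e i η x y * (S.miron e).C η μ ν x y = (S.miron e).C α μ ν x y := by
    simp only [Finset.mul_sum, ← mul_assoc]
    rw [Finset.sum_comm]
    simp [← Finset.sum_mul, S.sum_frame_mul_coframe he hx hy]
  simp only [canonical, h, mul_sub, Finset.sum_sub_distrib, h2]
  ring

omit he in
lemma vDeriv_congr {C C' : Fin n → Fin n → Fin n → Fld n} {x y : Coord n}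
    (h : ∀ α μ ν, C α μ ν x y = C' α μ ν x y) {r s : ℕ} (X : Tens n r s)
    (a : Fin r → Fin n) (b : Fin s → Fin n) (ν : Fin n) :
    vDeriv C X a b ν x y = vDeriv C' X a b ν x y := by
  simp only [vDeriv, h]

lemma verticalDerivativesGeneral {x y : Coord n} (hx : x ∈ e.target) (hy : y ≠ 0) :
    S.VerticalDerivativesGeneral e x y := fun r s X a b ν =>
  ⟨vDeriv_congr (S.cartan_C_eq he hx hy) X a b ν, vDeriv_congr (S.miron_C_eq he hx hy) X a b ν,
    vDeriv_congr (S.canonical_C_eq he hx hy) X a b ν,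
    vDeriv_congr (fun α μ ν => S.canonical_C_eq he hx hy α ν μ) X a b ν,
    by simp [Connection.vCov, vDeriv, berwald]⟩

omit he in
/-- The vanishing of the horizontal derivative of the Cartan tensor kills the `hv`-curvature. -/
lemma IsMinkowskian.cartanCurvaturesVanish (h : S.IsMinkowskian) : S.CartanCurvaturesVanish :=
  fun e he x hx y hy => ⟨(h e he x hx y hy).1,
    (S.isFinslerMetric he).curvP_eq_zero_of_hCov_C hx hy (h e he x hx y hy).2⟩

end FPSpace

/-! ### Consequences of vanishing Cartan curvatures -/

section CartanCurvatures

namespace FPSpace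

variable {M : Type*} [TopologicalSpace M] [ChartedSpace (Coord n) M]
  [IsManifold 𝓘(ℝ, Coord n) ∞ M] (S : FPSpace n M)

/-- Stated for the Cartan connection, but the `(v)h`-torsion depends only on the nonlinear
connection, which is the Barthel connection for all five connections. -/
lemma torsionR_eq_zero (h : S.CartanCurvaturesVanish) :
    S.Everywhere fun e x y => ∀ α μ ν, (S.cartan e).torsionR α μ ν x y = 0 :=
  fun _ he _ hx y hy =>
    (S.isFinslerMetric he).torsionR_eq_zero_of_curvR hx hy (h _ he _ hx y hy).1

lemma berwald_torsion_eq_zero (h : S.CartanCurvaturesVanish) :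
    S.Everywhere fun e x y => ∀ α μ ν,
      (S.berwald e).torsionT α μ ν x y = 0 ∧
      (S.berwald e).torsionC α μ ν x y = 0 ∧
      (S.berwald e).torsionR α μ ν x y = 0 ∧
      (S.berwald e).torsionP α μ ν x y = 0 ∧
      (S.berwald e).torsionS α μ ν x y = 0 := fun e he x hx y hy α μ ν =>
  ⟨(S.isFinslerMetric he).berwald_torsionT hx hy α μ ν, rfl,
    S.torsionR_eq_zero h e he x hx y hy α μ ν, sub_self _, sub_self _⟩

lemma berwald_curv (h : S.CartanCurvaturesVanish) :
    S.Everywhere fun e x y => ∀ α μ ν σ,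
      (S.berwald e).curvR α μ ν σ x y = 0 ∧
      (S.berwald e).curvP α μ ν σ x y =
        (S.cartan e).hCov (tens12 (S.cartan e).C) ![α] ![μ, σ] ν x y ∧
      (S.berwald e).curvS α μ ν σ x y = 0 := fun e he x hx y hy α μ ν σ =>
  have H := S.isFinslerMetric he
  have hP := fun x hx y hy => (h e he x hx y hy).2
  ⟨H.berwald_curvR hx hy hP (h e he x hx y hy).1 α μ ν σ, H.berwald_curvP hx hy hP α μ ν σ,
    IsFinslerMetric.berwald_curvS α μ ν σ⟩

lemma cartan_torsion_eq_zero (h : S.CartanCurvaturesVanish) :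
    S.Everywhere fun e x y => ∀ α μ ν,
      (S.cartan e).torsionT α μ ν x y = 0 ∧
      (S.cartan e).torsionR α μ ν x y = 0 ∧
      (S.cartan e).torsionP α μ ν x y = 0 ∧
      (S.cartan e).torsionS α μ ν x y = 0 := fun e he x hx y hy α μ ν =>
  have H := S.isFinslerMetric he
  ⟨sub_eq_zero.2 (H.F_symm hx hy α μ ν), S.torsionR_eq_zero h e he x hx y hy α μ ν,
    H.torsionP_eq_zero_of_curvP hx hy (h e he x hx y hy).2 α μ ν,
    sub_eq_zero.2 (H.C_symm hx hy α μ ν)⟩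

end FPSpace

end CartanCurvatures

end FPGeometry

end

theorem proposition4p11 {n : ℕ} {M : Type*} [TopologicalSpace M]
    [ChartedSpace (FPGeometry.Coord n) M]
    [IsManifold (modelWithCornersSelf ℝ (FPGeometry.Coord n)) (⊤ : ℕ∞) M]
    (S : FPGeometry.FPSpace n M) :
    -- FP-Minkowskian manifolds
    (S.IsMinkowskian → S.Everywhere fun e x y =>
      -- (a) vertical covariant derivatives are as in the general case
      S.VerticalDerivativesGeneral e x y ∧
      -- (b) the (v)h-torsion of every connection vanishes
      (∀ α μ ν,
        (S.cartan e).torsionR α μ ν x y = 0 ∧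
        (S.miron e).torsionR α μ ν x y = 0 ∧
        (S.canonical e).torsionR α μ ν x y = 0 ∧
        (S.dual e).torsionR α μ ν x y = 0 ∧
        (S.berwald e).torsionR α μ ν x y = 0) ∧
      -- (c) all torsion and curvature tensors of the Berwald connection vanish
      (∀ α μ ν,
        (S.berwald e).torsionT α μ ν x y = 0 ∧
        (S.berwald e).torsionC α μ ν x y = 0 ∧
        (S.berwald e).torsionR α μ ν x y = 0 ∧
        (S.berwald e).torsionP α μ ν x y = 0 ∧
        (S.berwald e).torsionS α μ ν x y = 0) ∧
      (∀ α μ ν σ,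
        (S.berwald e).curvR α μ ν σ x y = 0 ∧
        (S.berwald e).curvP α μ ν σ x y = 0 ∧
        (S.berwald e).curvS α μ ν σ x y = 0) ∧
      -- (d) all torsion and curvature tensors of the Cartan connection vanish, except for the
      -- (h)hv-torsion and the v-curvature
      (∀ α μ ν,
        (S.cartan e).torsionT α μ ν x y = 0 ∧
        (S.cartan e).torsionR α μ ν x y = 0 ∧
        (S.cartan e).torsionP α μ ν x y = 0 ∧
        (S.cartan e).torsionS α μ ν x y = 0) ∧
      (∀ α μ ν σ,
        (S.cartan e).curvR α μ ν σ x y = 0 ∧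
        (S.cartan e).curvP α μ ν σ x y = 0)) ∧
    -- the same, if only the h- and hv-curvature tensors of the Cartan connection are known to
    -- vanish; here the hv-curvature of the Berwald connection is the horizontal derivative of C
    (S.CartanCurvaturesVanish → S.Everywhere fun e x y =>
      S.VerticalDerivativesGeneral e x y ∧
      (∀ α μ ν,
        (S.cartan e).torsionR α μ ν x y = 0 ∧
        (S.miron e).torsionR α μ ν x y = 0 ∧
        (S.canonical e).torsionR α μ ν x y = 0 ∧
        (S.dual e).torsionR α μ ν x y = 0 ∧
        (S.berwald e).torsionR α μ ν x y = 0) ∧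
      (∀ α μ ν,
        (S.berwald e).torsionT α μ ν x y = 0 ∧
        (S.berwald e).torsionC α μ ν x y = 0 ∧
        (S.berwald e).torsionR α μ ν x y = 0 ∧
        (S.berwald e).torsionP α μ ν x y = 0 ∧
        (S.berwald e).torsionS α μ ν x y = 0) ∧
      (∀ α μ ν σ,
        (S.berwald e).curvR α μ ν σ x y = 0 ∧
        (S.berwald e).curvP α μ ν σ x y
          = (S.cartan e).hCov (FPGeometry.tens12 (S.cartan e).C) ![α] ![μ, σ] ν x y ∧
        (S.berwald e).curvS α μ ν σ x y = 0) ∧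
      (∀ α μ ν,
        (S.cartan e).torsionT α μ ν x y = 0 ∧
        (S.cartan e).torsionR α μ ν x y = 0 ∧
        (S.cartan e).torsionP α μ ν x y = 0 ∧
        (S.cartan e).torsionS α μ ν x y = 0) ∧
      (∀ α μ ν σ,
        (S.cartan e).curvR α μ ν σ x y = 0 ∧
        (S.cartan e).curvP α μ ν σ x y = 0)) := by
  refine ⟨fun hM e he x hx y hy => ?_, fun h e he x hx y hy => ?_⟩
  · have h := hM.cartanCurvaturesVanish
    have hR := S.torsionR_eq_zero h e he x hx y hy
    refine ⟨S.verticalDerivativesGeneral he hx hy,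
      fun α μ ν => ⟨hR α μ ν, hR α μ ν, hR α μ ν, hR α μ ν, hR α μ ν⟩,
      S.berwald_torsion_eq_zero h e he x hx y hy, fun α μ ν σ => ?_,
      S.cartan_torsion_eq_zero h e he x hx y hy,
      fun α μ ν σ => ⟨(h e he x hx y hy).1 α μ ν σ, (h e he x hx y hy).2 α μ ν σ⟩⟩
    obtain ⟨hBR, hBP, hBS⟩ := S.berwald_curv h e he x hx y hy α μ ν σ
    exact ⟨hBR, hBP.trans ((hM e he x hx y hy).2 α μ σ ν), hBS⟩
  · have hR := S.torsionR_eq_zero h e he x hx y hy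
    exact ⟨S.verticalDerivativesGeneral he hx hy,
      fun α μ ν => ⟨hR α μ ν, hR α μ ν, hR α μ ν, hR α μ ν, hR α μ ν⟩,
      S.berwald_torsion_eq_zero h e he x hx y hy, S.berwald_curv h e he x hx y hy,
      S.cartan_torsion_eq_zero h e he x hx y hy,
      fun α μ ν σ => ⟨(h e he x hx y hy).1 α μ ν σ, (h e he x hx y hy).2 α μ ν σ⟩⟩
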